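/- Let $s\in\mathbb{C}$ be neither $0$ nor an odd positive integer, and for $N\ge 2$ let $$\mathcal{L}_s(N)=\sum_{j\ne k}|z_{j}-z_{k}|^{-s},\qquad z_{k}=e^{2\pi i (k-1)/N},\ 1\le j,k\le N,$$ be the Riesz $s$-energy of the $N$-th roots of unity, where $a^{-s}=e^{-s\ln a}$ for $a>0$. Put $$V_s=\frac{2^{-s}\,\Gamma((1-s)/2)}{\sqrt{\pi}\,\Gamma(1-s/2)}$$ (so $V_s=0$ for $s=2,4,6,\dots$), let $\zeta$ be the analytically continued Riemann zeta function, and let $\alpha_n(s)$ be the Taylor coefficients defined by $$\left(\frac{\sin \pi z}{\pi z}\right)^{-s}=\sum_{n=0}^\infty \alpha_n(s)z^{2n},\qquad |z|<1,$$ where the power is the analytic branch with value $1$ at $z=0$. Then, for every integer $p\ge 0$, $$\mathcal{L}_s(N)=V_sN^2+\frac{2}{(2\pi)^s}\sum_{n=0}^{p}\alpha_n(s)\,\zeta(s-2n)\,N^{1+s-2n}+O_{s,p}\bigl(N^{-1+\operatorname{Re}s-2p}\bigr),\qquad N\to\infty.$$ If moreover $s=-2M$ with an integer $M\ge 1$,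 then $\zeta(s-2n)=0$ for all $n\ge 0$, and the expansion terminates in the exact formula $\mathcal{L}_s(N)=V_sN^2$ for all $N>M$. -/

import Mathlib

open Asymptotics Filter

namespace RieszCircle

noncomputable section

/-- The Riesz `s`-energy `∑_{j ≠ k} |z_j - z_k|^{-s}` of `N` points of the complex plane,
for complex `s` (`a ^ (-s) = exp (-s log a)` for real `a > 0`). -/
def rieszEnergy (s : ℂ) {N : ℕ} (z : Fin N → ℂ) : ℂ :=
  ∑ j : Fin N, ∑ k ∈ Finset.univ.erase j, ((‖z j - z k‖ : ℝ) : ℂ) ^ (-s)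

/-- The `N`-th roots of unity `exp (2 π i k / N)`, `k = 0, …, N - 1`. -/
def unityPoints (N : ℕ) (k : Fin N) : ℂ :=
  Complex.exp (2 * Real.pi * Complex.I * ((k : ℕ) : ℂ) / (N : ℂ))

/-- The Riesz `s`-energy `L_s(N)` of the `N`-th roots of unity. -/
def unityEnergy (s : ℂ) (N : ℕ) : ℂ :=
  rieszEnergy s (unityPoints N)

/-- The normalized `sinc` function `sin (π z) / (π z)`, with value `1` at `0`. -/
def csinc (z : ℂ) : ℂ :=
  if z = 0 then 1 else Complex.sin (Real.pi * z) / (Real.pi * z)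

/-- `α_n(s)`: the coefficient of `z ^ (2 n)` in the Taylor series at `0` of `csinc z ^ (-s)`.
Near `0` the values of `csinc` are close to `1`, so the principal power is there the
analytic branch with value `1` at `0`. -/
def alpha (n : ℕ) (s : ℂ) : ℂ :=
  iteratedDeriv (2 * n) (fun z : ℂ => csinc z ^ (-s)) 0 / ((2 * n).factorial : ℂ)

/-- `V_s = 2^{-s} Γ((1-s)/2) / (√π Γ(1-s/2))`, for `s` not an odd positive integer. When `s` is
an even positive integer, `1 / Γ(1-s/2)` is zero, in agreement with Mathlib's conventions
(`Complex.Gamma` is `0` at the poles and `x / 0 = 0`). -/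
def circleV (s : ℂ) : ℂ :=
  (2 : ℂ) ^ (-s) * Complex.Gamma ((1 - s) / 2) /
    ((Real.sqrt Real.pi : ℂ) * Complex.Gamma (1 - s / 2))

end

end RieszCircle

/-! Since |e^{iθ} - e^{iφ}| = 2|sin((θ-φ)/2)|, the energy is N times the sum of K(k/N), 0 ≤ k < N,
with K(x) = |2 sin πx|^(-s) of period 1 and the convention K(0) = 0 (`unityEnergy_eq`). So
everything rests on a trapezoidal rule for a periodic function whose only singularity per period, at
x = 0, has the expansion K(x) = (2π)^(-s) ∑ α_n(s) |x|^(2n-s).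

The singular terms are removed by periodic functions with the same singularity, whose sums over the
lattice are known exactly. These are 2 `hurwitzZetaEven` x (s-2n), the continuation of ∑_{m∈ℤ}
|x+m|^(-(s-2n)). It differs from |x|^(-(s-2n)) by a function analytic near 0
(`two_mul_hurwitzZetaEven`), and its values at k/N add up to 2 N^(s-2n) ζ(s-2n)
(`sum_hurwitzZetaEven`); this produces the zeta terms of the expansion. After P such subtractions
the remainder behaves like |x|^(2P-s), so it is of class C^K as soon as Re s + K < 2P
(`contDiff_kernelRemainder`), and the trapezoidal rule sums it with error O(N^(1-K)) by decay of
Fourier coefficients (`trapezoid`).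

It remains to see that the remainder has integral V_s. Over half a period, the analytic part of each
subtracted zeta function integrates to what the continuation of ∫ x^(2n-s) dx contributes
(`integral_hurwitzSeries`), so the integral is a series that does not depend on P. For Re s < 1 this
series is the Beta integral of K, that is V_s; both sides are analytic off the odd positive
integers, whence equality there (`circleV_eq_tsum`).

For s = -2M the kernel is a trigonometric polynomial of degree M. With N > M points only its
constant term, the central binomial coefficient V_s, survives in the lattice sum. -/

namespace RieszCircle

/-! ### Fourier coefficients and the trapezoidal rule -/

section Trapezoid

open Complex Function

/-- The `m`-th Fourier coefficient over `[0, 1]`. -/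
noncomputable def fourierInt (h : ℝ → ℂ) (m : ℤ) : ℂ :=
  ∫ x in (0 : ℝ)..1, exp (-(2 * Real.pi * I * m * x)) * h x

lemma exp_two_pi_int (m : ℤ) : exp (-(2 * Real.pi * I * m)) = 1 := by
  rw [exp_eq_one_iff]
  exact ⟨-m, by push_cast; ring⟩

lemma fourierInt_eq_deriv {h : ℝ → ℂ} (hp : Periodic h 1) (hc : ContDiff ℝ 1 h) {m : ℤ}
    (hm : m ≠ 0) : fourierInt h m = (2 * Real.pi * I * m)⁻¹ * fourierInt (deriv h) m := by
  set c : ℂ := 2 * Real.pi * I * m with hcdef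
  have hc0 : c ≠ 0 := by
    simp [hcdef, Real.pi_ne_zero, hm]
  have hu : ∀ x : ℝ, HasDerivAt (fun x : ℝ => -c⁻¹ * exp (-(c * x))) (exp (-(c * x))) x := by
    intro x
    have h1 : HasDerivAt (fun x : ℝ => -(c * (x : ℂ))) (-(c * 1)) x :=
      ((hasDerivAt_id x).ofReal_comp.const_mul c).neg
    have := h1.cexp.const_mul (-c⁻¹)
    refine this.congr_deriv ?_
    linear_combination (exp (-(c * x))) * inv_mul_cancel₀ hc0
  have hv : ∀ x : ℝ, HasDerivAt h (deriv h x) x := fun x =>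
    (hc.differentiable (by norm_num) x).hasDerivAt
  have hcd : Continuous (deriv h) := hc.continuous_deriv le_rfl
  have key := intervalIntegral.integral_deriv_mul_eq_sub (a := 0) (b := 1)
    (u := fun x : ℝ => -c⁻¹ * exp (-(c * x))) (v := h) (u' := fun x : ℝ => exp (-(c * x)))
    (v' := deriv h)
    (fun x _ => hu x) (fun x _ => hv x) (Continuous.intervalIntegrable (by fun_prop) _ _)
    (Continuous.intervalIntegrable (by fun_prop) _ _)
  have h1 : h 1 = h 0 := by simpa using hp 0
  have h2 : exp (-(c * (1 : ℝ))) = 1 := by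
    rw [ofReal_one, mul_one]; exact exp_two_pi_int m
  rw [h1, h2] at key
  simp only [ofReal_zero, mul_zero, neg_zero, exp_zero, sub_self] at key
  rw [intervalIntegral.integral_add (Continuous.intervalIntegrable (by fun_prop) _ _)
    (Continuous.intervalIntegrable (by fun_prop) _ _)] at key
  have h3 : (∫ x in (0 : ℝ)..1, -c⁻¹ * exp (-(c * x)) * deriv h x)
      = -c⁻¹ * fourierInt (deriv h) m := by
    rw [fourierInt, ← intervalIntegral.integral_const_mul]
    simp only [hcdef, mul_assoc]
  rw [h3] at key
  have h4 : fourierInt h m = ∫ x in (0 : ℝ)..1, exp (-(c * x)) * h x := rfl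
  rw [h4]
  linear_combination key

/-- K integrations by parts, each gaining a factor 1/(2π|m|), of which only 1/|m| is kept. -/
lemma fourierInt_bound (K : ℕ) : ∀ {h : ℝ → ℂ}, Periodic h 1 → ContDiff ℝ K h →
    ∃ C : ℝ, ∀ m : ℤ, m ≠ 0 → ‖fourierInt h m‖ ≤ C / |(m : ℝ)| ^ K := by
  induction K with
  | zero =>
    intro h hp hc
    have hcont : Continuous h := hc.continuous
    refine ⟨∫ x in (0 : ℝ)..1, ‖h x‖, fun m _ => ?_⟩
    simp only [pow_zero, div_one]
    refine (intervalIntegral.norm_integral_le_integral_norm zero_le_one).trans_eq ?_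
    congr 1
    ext x
    rw [norm_mul]
    have : -(2 * Real.pi * I * m * x) = ((-(2 * Real.pi * m * x) : ℝ) : ℂ) * I := by
      push_cast; ring
    rw [this, norm_exp_ofReal_mul_I, one_mul]
  | succ K ih =>
    intro h hp hc
    have hc1 : ContDiff ℝ 1 h := hc.of_le (by norm_cast; omega)
    have hd : ContDiff ℝ K (deriv h) := by
      have := hc
      rw [show ((K + 1 : ℕ) : WithTop ℕ∞) = (K : WithTop ℕ∞) + 1 by norm_cast] at this
      exact (contDiff_succ_iff_deriv.mp this).2.2
    have hdp : Periodic (deriv h) 1 := by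
      intro x
      have : (fun y => h (y + 1)) = h := funext hp
      rw [← deriv_comp_add_const, this]
    obtain ⟨C, hC⟩ := ih hdp hd
    refine ⟨C, fun m hm => ?_⟩
    have hmpos : 0 < |(m : ℝ)| := abs_pos.mpr (by exact_mod_cast hm)
    rw [fourierInt_eq_deriv hp hc1 hm, norm_mul, norm_inv, pow_succ]
    have h1 : ‖(2 * Real.pi * I * m : ℂ)‖ = 2 * Real.pi * |(m : ℝ)| := by
      simp [abs_of_pos Real.pi_pos]
    rw [h1]
    have h2 : (2 * Real.pi * |(m : ℝ)|)⁻¹ ≤ |(m : ℝ)|⁻¹ := by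
      apply inv_anti₀ hmpos
      nlinarith [Real.pi_gt_three]
    calc (2 * Real.pi * |(m : ℝ)|)⁻¹ * ‖fourierInt (deriv h) m‖
        ≤ |(m : ℝ)|⁻¹ * (C / |(m : ℝ)| ^ K) :=
          mul_le_mul h2 (hC m hm) (norm_nonneg _) (by positivity)
      _ = C / (|(m : ℝ)| ^ K * |(m : ℝ)|) := by field_simp

lemma hasSum_fourierInt {h : ℝ → ℂ} (hp : Periodic h 1) (hc : ContDiff ℝ 2 h) (x : ℝ) :
    HasSum (fun m : ℤ => fourierInt h m * exp (2 * Real.pi * I * m * x)) (h x) := by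
  have hcont : Continuous h := hc.continuous
  have : Fact ((0 : ℝ) < 1) := ⟨one_pos⟩
  let F : C(AddCircle (1 : ℝ), ℂ) := ⟨hp.lift, by
    exact continuous_coinduced_dom.mpr hcont⟩
  have hF : ∀ y : ℝ, F (y : AddCircle (1 : ℝ)) = h y := fun y => hp.lift_coe y
  have hcoef : ∀ m : ℤ, fourierCoeff F m = fourierInt h m := by
    intro m
    rw [fourierCoeff_eq_intervalIntegral F m 0, fourierInt]
    simp only [zero_add, ne_eq, one_ne_zero, not_false_eq_true, div_self, one_smul, smul_eq_mul]
    congr 1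
    ext y
    rw [hF, fourier_coe_apply]
    congr 2
    push_cast
    ring
  obtain ⟨C, hC⟩ := fourierInt_bound 2 hp hc
  have hsum : Summable (fourierCoeff F) := by
    have h1 : Summable (fun m : ℤ => C * (1 / (m : ℝ) ^ 2)) :=
      (Real.summable_one_div_int_pow.mpr one_lt_two).mul_left C
    refine Summable.of_norm_bounded_eventually h1 ?_
    have : {(0 : ℤ)}ᶜ ∈ cofinite := (Set.finite_singleton (0 : ℤ)).compl_mem_cofinite
    filter_upwards [this] with m hm
    rw [hcoef]
    simpa [div_eq_mul_inv] using hC m hm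
  have := has_pointwise_sum_fourier_series_of_summable hsum (x : AddCircle (1 : ℝ))
  rw [hF] at this
  refine this.congr_fun fun m => ?_
  rw [hcoef, fourier_coe_apply, smul_eq_mul]
  congr 2
  push_cast
  ring

lemma sum_exp_lattice {N : ℕ} (hN : N ≠ 0) (m : ℤ) :
    ∑ k ∈ Finset.range N, exp (2 * Real.pi * I * m * ((k / N : ℝ) : ℂ))
      = if (N : ℤ) ∣ m then (N : ℂ) else 0 := by
  have hN' : (N : ℂ) ≠ 0 := by exact_mod_cast hN
  set q : ℂ := exp (2 * Real.pi * I * m / N) with hq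
  have hterm : ∀ k : ℕ, exp (2 * Real.pi * I * m * ((k / N : ℝ) : ℂ)) = q ^ k := by
    intro k
    rw [hq, ← exp_nat_mul]
    congr 1
    push_cast
    ring
  simp only [hterm]
  have hqN : q ^ N = 1 := by
    rw [hq, ← exp_nat_mul, exp_eq_one_iff]
    exact ⟨m, by field_simp⟩
  split_ifs with hd
  · obtain ⟨l, rfl⟩ := hd
    have : q = 1 := by
      rw [hq, exp_eq_one_iff]
      exact ⟨l, by push_cast; field_simp⟩
    simp [this]
  · have hq1 : q ≠ 1 := by
      intro h
      rw [hq, exp_eq_one_iff] at h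
      obtain ⟨l, hl⟩ := h
      apply hd
      refine ⟨l, ?_⟩
      have h2 : (2 * Real.pi * I : ℂ) ≠ 0 := by simp [Real.pi_ne_zero]
      have h3 : (2 * Real.pi * I : ℂ) * m = (2 * Real.pi * I : ℂ) * (N * l) := by
        field_simp at hl ⊢
        linear_combination hl
      exact_mod_cast mul_left_cancel₀ h2 h3
    rw [geom_sum_eq hq1, hqN, sub_self, zero_div]

/-- The trapezoidal rule for periodic functions of class `C^K`. -/
theorem trapezoid {h : ℝ → ℂ} (hp : Periodic h 1) {K : ℕ} (hK : 2 ≤ K) (hc : ContDiff ℝ K h) :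
    ∃ C : ℝ, ∀ N : ℕ, N ≠ 0 →
      ‖∑ k ∈ Finset.range N, h (k / N) - N * ∫ x in (0 : ℝ)..1, h x‖
        ≤ C * ((N : ℝ) / (N : ℝ) ^ K) := by
  obtain ⟨C, hC⟩ := fourierInt_bound K hp hc
  have hc2 : ContDiff ℝ 2 h := hc.of_le (by exact_mod_cast hK)
  refine ⟨C * ∑' l : ℤ, 1 / |(l : ℝ)| ^ K, fun N hN => ?_⟩
  have hNpos : (0 : ℝ) < N := by exact_mod_cast Nat.pos_of_ne_zero hN
  -- Aliasing: summing the Fourier series over the lattice keeps exactly the frequencies divisible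
  -- by N. Frequency 0 gives the integral, the others the error.
  have h1 : HasSum (fun m : ℤ => fourierInt h m * if (N : ℤ) ∣ m then (N : ℂ) else 0)
      (∑ k ∈ Finset.range N, h (k / N)) := by
    have := hasSum_sum (s := Finset.range N) (fun k _ => hasSum_fourierInt hp hc2 ((k / N : ℝ)))
    refine this.congr_fun fun m => ?_
    rw [← Finset.mul_sum, sum_exp_lattice hN]
  have hinj : Injective (fun l : ℤ => (N : ℤ) * l) := by
    intro a b hab
    exact mul_left_cancel₀ (by exact_mod_cast hN) hab
  have h2 : HasSum (fun l : ℤ => fourierInt h (N * l) * N)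
      (∑ k ∈ Finset.range N, h (k / N)) := by
    refine ((hinj.hasSum_iff ?_).mpr h1).congr_fun fun l => ?_
    · intro m hm
      rw [if_neg, mul_zero]
      rintro ⟨l, rfl⟩
      exact hm ⟨l, rfl⟩
    · simp
  have h0 : fourierInt h 0 = ∫ x in (0 : ℝ)..1, h x := by simp [fourierInt]
  have h3 := h2.sub (hasSum_ite_eq (0 : ℤ) ((N : ℂ) * ∫ x in (0 : ℝ)..1, h x))
  have hs : Summable (fun l : ℤ => 1 / |(l : ℝ)| ^ K) := by
    have := (Real.summable_one_div_int_pow (p := K)).mpr (by omega)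
    refine this.abs.congr fun l => ?_
    simp [abs_pow]
  have h4 := (hs.hasSum.mul_left (C * ((N : ℝ) / (N : ℝ) ^ K)))
  have h5 := h3.norm_le_of_bounded h4 (fun l => ?_)
  · calc _ ≤ _ := h5
      _ = _ := by ring
  · rcases eq_or_ne l 0 with rfl | hl
    -- Both sides vanish at l = 0: the integral has been subtracted, and 1 / 0 ^ K = 0.
    · simp [h0, mul_comm, show K ≠ 0 by omega]
    · rw [if_neg hl, sub_zero, norm_mul]
      have := hC (N * l) (mul_ne_zero (by exact_mod_cast hN) hl)
      have hlpos : 0 < |(l : ℝ)| := abs_pos.mpr (by exact_mod_cast hl)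
      calc ‖fourierInt h (N * l)‖ * ‖(N : ℂ)‖ ≤ C / |((N * l : ℤ) : ℝ)| ^ K * N := by
            rw [Complex.norm_natCast]
            exact mul_le_mul_of_nonneg_right this hNpos.le
        _ = _ := by
            push_cast
            rw [abs_mul, Nat.abs_cast, mul_pow]
            field_simp

end Trapezoid

/-! ### Smoothness of complex powers of |x| -/

section AbsCpow

open Complex

/-- Only the size |x|^(Re a) = o(|x|) matters. Assuming just the norm of g lets the lemma serve both
|x|^a and x|x|^(a-1). -/
lemma hasDerivAt_abs_cpow_zero {a : ℂ} (ha : 1 < a.re) (g : ℝ → ℂ)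
    (hg : ∀ x, ‖g x‖ = ‖((|x| : ℝ) : ℂ) ^ a‖) : HasDerivAt g 0 0 := by
  have ha0 : a.re ≠ 0 := by linarith
  have hn : ∀ x, ‖g x‖ = |x| ^ a.re := fun x => by
    rw [hg, norm_cpow_eq_rpow_re_of_nonneg (abs_nonneg x) ha0]
  have g0 : g 0 = 0 := by
    rw [← norm_eq_zero, hn, abs_zero, Real.zero_rpow ha0]
  rw [hasDerivAt_iff_isLittleO_nhds_zero]
  simp only [zero_add, g0, sub_zero, smul_zero]
  rw [isLittleO_iff]
  intro c hc
  have h1 : Tendsto (fun x : ℝ => |x| ^ (a.re - 1)) (nhds 0) (nhds 0) := by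
    have : Continuous fun x : ℝ => |x| ^ (a.re - 1) :=
      continuous_abs.rpow_const fun x => Or.inr (by linarith)
    have h := this.tendsto 0
    rwa [abs_zero, Real.zero_rpow (by linarith)] at h
  filter_upwards [h1.eventually (gt_mem_nhds hc)] with x hx
  rw [hn, Real.norm_eq_abs]
  rcases eq_or_ne x 0 with rfl | hx0
  · simp [Real.zero_rpow ha0]
  · have hpos : 0 < |x| := abs_pos.mpr hx0
    calc |x| ^ a.re = |x| ^ (a.re - 1) * |x| := by
          rw [Real.rpow_sub_one hpos.ne']; field_simp
      _ ≤ c * |x| := by gcongr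

lemma hasDerivAt_cpow_of_pos {a : ℂ} (ha : a ≠ 0) {x : ℝ} (hx : 0 < x) :
    HasDerivAt (fun x : ℝ => (x : ℂ) ^ a) (a * (x : ℂ) ^ (a - 1)) x := by
  have h := hasDerivAt_ofReal_cpow_const' (r := a - 1) hx.ne' (by simpa [sub_eq_iff_eq_add] using ha)
  have := h.const_mul a
  simp only [sub_add_cancel] at this
  refine this.congr_of_eventuallyEq (Eventually.of_forall fun y => ?_)
  simp only
  rw [mul_div_cancel₀ _ ha]

lemma hasDerivAt_abs_cpow {a : ℂ} (ha : 1 < a.re) (x : ℝ) :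
    HasDerivAt (fun x : ℝ => ((|x| : ℝ) : ℂ) ^ a) (a * (x * ((|x| : ℝ) : ℂ) ^ (a - 2))) x := by
  have ha0 : a ≠ 0 := by rintro rfl; simp at ha; linarith
  rcases lt_trichotomy x 0 with hx | rfl | hx
  · have h := (hasDerivAt_cpow_of_pos ha0 (neg_pos.mpr hx)).scomp x (hasDerivAt_neg x)
    refine (h.congr_of_eventuallyEq ?_).congr_deriv ?_
    · filter_upwards [gt_mem_nhds hx] with y hy
      simp [abs_of_neg hy]
    · rw [abs_of_neg hx, show a - 1 = (a - 2) + 1 by ring,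
        cpow_add _ _ (by simpa using hx.ne)]
      push_cast
      rw [cpow_one, neg_one_smul]
      ring
  · simpa using hasDerivAt_abs_cpow_zero ha _ fun _ => rfl
  · refine ((hasDerivAt_cpow_of_pos ha0 hx).congr_of_eventuallyEq ?_).congr_deriv ?_
    · filter_upwards [lt_mem_nhds hx] with y hy
      simp [abs_of_pos hy]
    · rw [abs_of_pos hx, show a - 1 = (a - 2) + 1 by ring,
        cpow_add _ _ (by simpa using hx.ne')]
      rw [cpow_one]
      ring

lemma hasDerivAt_mul_abs_cpow {a : ℂ} (ha : 1 < a.re) (x : ℝ) :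
    HasDerivAt (fun x : ℝ => x * ((|x| : ℝ) : ℂ) ^ (a - 1)) (a * ((|x| : ℝ) : ℂ) ^ (a - 1)) x := by
  have ha0 : a ≠ 0 := by rintro rfl; simp at ha; linarith
  have ha1 : a - 1 ≠ 0 := by
    intro h; rw [sub_eq_zero.mp h] at ha; simp at ha
  have hmul : ∀ y : ℝ, y ≠ 0 → (((|y| : ℝ) : ℂ)) * ((|y| : ℝ) : ℂ) ^ (a - 1)
      = ((|y| : ℝ) : ℂ) ^ a := fun y hy => by
    have : (((|y| : ℝ) : ℂ)) ≠ 0 := by simpa using hy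
    rw [mul_comm, cpow_sub _ _ this, cpow_one, div_mul_cancel₀ _ this]
  rcases lt_trichotomy x 0 with hx | rfl | hx
  · have h := ((hasDerivAt_cpow_of_pos ha0 (neg_pos.mpr hx)).scomp x (hasDerivAt_neg x)).neg
    refine (h.congr_of_eventuallyEq ?_).congr_deriv ?_
    · filter_upwards [gt_mem_nhds hx] with y hy
      have := hmul y hy.ne
      rw [abs_of_neg hy] at this ⊢
      simp only [Pi.neg_apply, Function.comp_apply]
      rw [← this]
      push_cast
      ring
    · rw [abs_of_neg hx]
      simp
  · refine (hasDerivAt_abs_cpow_zero ha _ fun y => ?_).congr_deriv ?_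
    · rcases eq_or_ne y 0 with rfl | hy
      · simp [ha0]
      · rw [← hmul y hy]; simp
    · simp [ha1]
  · refine ((hasDerivAt_cpow_of_pos ha0 hx).congr_of_eventuallyEq ?_).congr_deriv ?_
    · filter_upwards [lt_mem_nhds hx] with y hy
      have := hmul y hy.ne'
      rwa [abs_of_pos hy] at this ⊢
    · simp [abs_of_pos hx]

/-- The two families are exchanged by differentiation, up to the factor a and the shift of a to a -
1, so they must be treated in one induction. -/
lemma contDiff_abs_cpow_and_mul (n : ℕ) : ∀ a : ℂ, (n : ℝ) < a.re →
    ContDiff ℝ n (fun x : ℝ => ((|x| : ℝ) : ℂ) ^ a) ∧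
    ContDiff ℝ n (fun x : ℝ => x * ((|x| : ℝ) : ℂ) ^ (a - 1)) := by
  induction n with
  | zero =>
    intro a ha
    simp only [Nat.cast_zero] at ha
    have ha0 : a ≠ 0 := by rintro rfl; simp at ha
    have hc : Continuous (fun x : ℝ => ((|x| : ℝ) : ℂ) ^ a) := by
      rw [continuous_iff_continuousAt]
      intro x
      rcases eq_or_ne x 0 with rfl | hx
      · have h := (continuousAt_ofReal_cpow_const (0 : ℝ) a (Or.inl ha))
        exact ContinuousAt.comp_of_eq (f := fun x : ℝ => |x|) (x := 0)
          (g := fun x : ℝ => (x : ℂ) ^ a) h continuous_abs.continuousAt (by simp)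
      · exact ContinuousAt.comp (f := fun x : ℝ => |x|) (g := fun x : ℝ => (x : ℂ) ^ a)
          (continuousAt_ofReal_cpow_const _ a (Or.inr (by simpa using hx)))
          continuous_abs.continuousAt
    have hnorm : ∀ x : ℝ, ‖(x * ((|x| : ℝ) : ℂ) ^ (a - 1) : ℂ)‖ = ‖((|x| : ℝ) : ℂ) ^ a‖ := by
      intro y
      rcases eq_or_ne y 0 with rfl | hy
      · simp [ha0]
      · have : (((|y| : ℝ) : ℂ)) ≠ 0 := by simpa using hy
        rw [cpow_sub _ _ this, cpow_one]
        simp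
        field_simp
    refine ⟨contDiff_zero.mpr hc, contDiff_zero.mpr ?_⟩
    rw [continuous_iff_continuousAt]
    intro x
    rcases eq_or_ne x 0 with rfl | hx
    · rw [ContinuousAt, ofReal_zero, zero_mul, tendsto_zero_iff_norm_tendsto_zero]
      simp only [hnorm]
      have := hc.norm.tendsto 0
      simpa [ha0] using this
    · exact (continuous_ofReal.continuousAt).mul
        (ContinuousAt.comp (f := fun x : ℝ => |x|) (g := fun x : ℝ => (x : ℂ) ^ (a - 1))
          (continuousAt_ofReal_cpow_const _ _ (Or.inr (by simpa using hx)))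
          continuous_abs.continuousAt)
  | succ n ih =>
    intro a ha
    push_cast at ha
    have ha1 : 1 < a.re := by have : (0 : ℝ) ≤ n := by positivity
                              linarith
    obtain ⟨i1, i2⟩ := ih (a - 1) (by simp; linarith)
    rw [show ((n + 1 : ℕ) : WithTop ℕ∞) = (n : WithTop ℕ∞) + 1 by norm_cast]
    constructor
    · rw [contDiff_succ_iff_deriv]
      refine ⟨fun x => (hasDerivAt_abs_cpow ha1 x).differentiableAt, by simp, ?_⟩
      rw [funext fun x => (hasDerivAt_abs_cpow ha1 x).deriv]
      have : a - 2 = a - 1 - 1 := by ring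
      rw [this]
      exact contDiff_const.mul i2
    · rw [contDiff_succ_iff_deriv]
      refine ⟨fun x => (hasDerivAt_mul_abs_cpow ha1 x).differentiableAt, by simp, ?_⟩
      rw [funext fun x => (hasDerivAt_mul_abs_cpow ha1 x).deriv]
      exact contDiff_const.mul i1

/-- `|x| ^ a` is of class `C^n` on the real line when `n < re a`. -/
theorem contDiff_abs_cpow {n : ℕ} {a : ℂ} (ha : (n : ℝ) < a.re) :
    ContDiff ℝ n (fun x : ℝ => ((|x| : ℝ) : ℂ) ^ a) :=
  (contDiff_abs_cpow_and_mul n a ha).1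

end AbsCpow

/-! ### The power series of the Hurwitz zeta function in its shift -/

section ZetaSeries

open Complex

/-- `w (w + 1) ⋯ (w + k - 1) / k!`, the Taylor coefficients of `(1 - y) ^ (-w)`. -/
noncomputable def risingCoeff (w : ℂ) (k : ℕ) : ℂ :=
  (∏ i ∈ Finset.range k, (w + i)) / k.factorial

lemma risingCoeff_eq_choose (w : ℂ) (k : ℕ) : Ring.choose (w + k - 1) k = risingCoeff w k := by
  have h : (ascPochhammer ℂ k).eval w = ∏ i ∈ Finset.range k, (w + i) := by
    induction k with
    | zero => simp
    | succ k ih => rw [ascPochhammer_succ_eval, ih, Finset.prod_range_succ]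
  rw [Ring.choose_eq_smul, risingCoeff, smul_eq_mul, div_eq_inv_mul,
    Polynomial.descPochhammer_smeval_eq_ascPochhammer, Polynomial.ascPochhammer_smeval_cast,
    Polynomial.ascPochhammer_smeval_eq_eval, show w + k - 1 - k + 1 = w by ring, h]

lemma differentiable_risingCoeff (k : ℕ) : Differentiable ℂ fun w => risingCoeff w k := by
  unfold risingCoeff
  fun_prop

lemma risingCoeff_succ (w : ℂ) (k : ℕ) :
    (k + 1) * risingCoeff w (k + 1) = (w + k) * risingCoeff w k := by
  unfold risingCoeff
  rw [Finset.prod_range_succ, Nat.factorial_succ]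
  have h1 : ((k.factorial : ℕ) : ℂ) ≠ 0 := by exact_mod_cast k.factorial_ne_zero
  have h2 : ((k : ℂ) + 1) ≠ 0 := by exact_mod_cast k.succ_ne_zero
  push_cast
  field_simp

/-- Both sides equal (w-1) w ⋯ (w+k-1) / k!. -/
lemma risingCoeff_sub_one (w : ℂ) (k : ℕ) :
    (w - 1) * risingCoeff w k = (w - 1 + k) * risingCoeff (w - 1) k := by
  unfold risingCoeff
  have h : (∏ i ∈ Finset.range k, (w + i)) * (w - 1)
      = (∏ i ∈ Finset.range k, (w - 1 + i)) * (w - 1 + k) := by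
    rw [← Finset.prod_range_succ (fun i : ℕ => w - 1 + (i : ℂ)), Finset.prod_range_succ']
    congr 1
    · refine Finset.prod_congr rfl fun i _ => ?_
      push_cast
      ring
    · simp
  rw [mul_div_assoc', mul_div_assoc', mul_comm, h, mul_comm]

lemma hasSum_risingCoeff (w : ℂ) {y : ℂ} (hy : ‖y‖ < 1) :
    HasSum (fun k => risingCoeff w k * y ^ k) ((1 - y) ^ (-w)) := by
  have h := (one_div_one_sub_cpow_hasFPowerSeriesOnBall_zero w).hasSum (y := y)
    (by rw [← ENNReal.ofReal_one, Metric.eball_ofReal]; simpa using hy)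
  simp only [FormalMultilinearSeries.ofScalars_apply_eq, zero_add, smul_eq_mul] at h
  rw [cpow_neg, ← one_div]
  exact h.congr_fun fun k => by rw [risingCoeff_eq_choose]

lemma norm_risingCoeff_le {w : ℂ} {m : ℕ} (hw : ‖w‖ ≤ m) (k : ℕ) :
    ‖risingCoeff w k‖ ≤ ((k + m).choose m : ℝ) := by
  have hk : (0 : ℝ) < k.factorial := by exact_mod_cast k.factorial_pos
  rw [risingCoeff, norm_div, norm_prod, norm_natCast, div_le_iff₀ hk]
  -- The bound m + i is weakened to m + 1 + i so that the product becomes an ascending factorial.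
  have h1 : ∏ i ∈ Finset.range k, ‖w + i‖ ≤ ∏ i ∈ Finset.range k, ((m + 1 + i : ℕ) : ℝ) := by
    refine Finset.prod_le_prod (fun _ _ => norm_nonneg _) fun i _ => ?_
    refine (norm_add_le _ _).trans ?_
    rw [norm_natCast]
    push_cast
    linarith
  refine h1.trans_eq ?_
  rw [← Nat.cast_prod, ← Nat.ascFactorial_eq_prod_range, Nat.ascFactorial_eq_factorial_mul_choose]
  push_cast
  rw [mul_comm, add_comm k m, ← Nat.choose_symm_add]

/-- The Taylor coefficients in `x` of `(w - 1) ∑_{n ≥ 1} (n - x) ^ (-w)`, entire in `w`. -/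
noncomputable def zetaTaylor (w : ℂ) (k : ℕ) : ℂ :=
  risingCoeff (w - 1) k * riemannZeta₁ (w + k)

lemma differentiable_zetaTaylor (k : ℕ) : Differentiable ℂ fun w => zetaTaylor w k := by
  unfold zetaTaylor
  have h1 := (differentiable_risingCoeff k).comp (differentiable_id.sub_const (1 : ℂ))
  have h2 := differentiable_riemannZeta₁.comp (differentiable_id.add_const (k : ℂ))
  exact h1.mul h2

/-- The factor w + k - 1 that turns ζ(w+k) into the entire function `riemannZeta₁` is the last
factor of (w-1) w ⋯ (w+k-1). -/
lemma zetaTaylor_eq {w : ℂ} {k : ℕ} (h : w + k ≠ 1) :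
    zetaTaylor w k = (w - 1) * (risingCoeff w k * riemannZeta (w + k)) := by
  have h1 : w + k - 1 ≠ 0 := sub_ne_zero.mpr h
  rw [zetaTaylor, ← mul_assoc, risingCoeff_sub_one, riemannZeta_eq_inv_sub_mul h]
  have : w - 1 + k = w + k - 1 := by ring
  rw [this]
  field_simp

lemma exists_norm_riemannZeta_le : ∃ C : ℝ, ∀ u : ℂ, 2 ≤ u.re → ‖riemannZeta u‖ ≤ C := by
  refine ⟨∑' n : ℕ, 1 / ((n : ℝ) + 1) ^ (2 : ℝ), fun u hu => ?_⟩
  have hs : Summable fun n : ℕ => 1 / ((n : ℝ) + 1) ^ (2 : ℝ) := by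
    have := (summable_nat_add_iff 1).mpr (Real.summable_one_div_nat_rpow.mpr one_lt_two)
    simpa using this
  rw [zeta_eq_tsum_one_div_nat_add_one_cpow (by linarith)]
  refine tsum_of_norm_bounded hs.hasSum fun n => ?_
  have hpos : (0 : ℝ) < (n : ℝ) + 1 := by positivity
  have : ((n : ℂ) + 1) = (((n : ℝ) + 1 : ℝ) : ℂ) := by push_cast; rfl
  rw [norm_div, norm_one, this, norm_cpow_eq_rpow_re_of_pos hpos]
  gcongr
  linarith [show (0 : ℝ) ≤ n by positivity]

lemma exists_norm_riemannZeta₁_le (R : ℕ) :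
    ∃ C : ℝ, 0 ≤ C ∧ ∀ (k : ℕ) (w : ℂ), ‖w‖ ≤ R → ‖riemannZeta₁ (w + k)‖ ≤ C * (k + 1) := by
  obtain ⟨C₁, hC₁⟩ := exists_norm_riemannZeta_le
  obtain ⟨C₂, hC₂⟩ := (isCompact_closedBall (0 : ℂ) (2 * R + 2)).exists_bound_of_continuousOn
    differentiable_riemannZeta₁.continuous.continuousOn
  have hC₁0 : 0 ≤ C₁ := (norm_nonneg _).trans (hC₁ 2 (by simp))
  have hC₂0 : 0 ≤ C₂ := (norm_nonneg _).trans (hC₂ 0 (by simp; positivity))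
  refine ⟨C₂ + (R + 1) * C₁, by positivity, fun k w hw => ?_⟩
  have hk : (0 : ℝ) ≤ k := by positivity
  have hR : (0 : ℝ) ≤ R := by positivity
  -- For small k the arguments stay in a compact disc. For large k they lie in Re ≥ 2, where ζ is
  -- bounded and only the factor w + k - 1 grows.
  rcases le_or_gt k (R + 2) with h | h
  · have hk' : (k : ℝ) ≤ R + 2 := by exact_mod_cast h
    have hb : ‖riemannZeta₁ (w + k)‖ ≤ C₂ := by
      apply hC₂
      rw [mem_closedBall_zero_iff]
      refine (norm_add_le _ _).trans ?_
      rw [norm_natCast]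
      linarith
    nlinarith [mul_nonneg (add_nonneg hR zero_le_one) hC₁0]
  · have hk' : (R : ℝ) + 2 ≤ k := by exact_mod_cast h.le
    have hre : 2 ≤ (w + k).re := by
      have := (abs_le.mp ((abs_re_le_norm w).trans hw)).1
      simp
      linarith
    have hne : w + k ≠ 1 := by
      intro h0
      rw [h0] at hre
      norm_num at hre
    have hz : riemannZeta₁ (w + k) = (w + k - 1) * riemannZeta (w + k) := by
      rw [riemannZeta_eq_inv_sub_mul hne, mul_inv_cancel_left₀ (sub_ne_zero.mpr hne)]
    have hn : ‖w + k - 1‖ ≤ R + 1 + k := by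
      have h1 := norm_sub_le (w + k) 1
      have h2 := norm_add_le w (k : ℂ)
      rw [norm_natCast] at h2
      rw [norm_one] at h1
      linarith
    rw [hz, norm_mul]
    calc ‖w + k - 1‖ * ‖riemannZeta (w + k)‖ ≤ (R + 1 + k) * C₁ :=
          mul_le_mul hn (hC₁ _ hre) (norm_nonneg _) (by positivity)
      _ ≤ _ := by nlinarith [mul_nonneg hR hk, mul_nonneg (mul_nonneg hR hk) hC₁0,
          mul_nonneg hk hC₂0]

/-- Locally uniform bounds for the series `∑ zetaTaylor w k * x ^ k`. -/
lemma exists_summable_zetaTaylor (R : ℝ) {r : ℝ} (hr0 : 0 ≤ r) (hr : r < 1) :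
    ∃ u : ℕ → ℝ, Summable u ∧ ∀ (k : ℕ) (w x : ℂ), ‖w‖ ≤ R → ‖x‖ ≤ r →
      ‖zetaTaylor w k * x ^ k‖ ≤ u k := by
  obtain ⟨m, hm⟩ := exists_nat_ge (R + 1)
  obtain ⟨C, hC0, hC⟩ := exists_norm_riemannZeta₁_le m
  refine ⟨fun k => C * (m + 1) * (((k + (m + 1)).choose (m + 1) : ℝ) * r ^ k), ?_, ?_⟩
  · exact Summable.mul_left (C * (m + 1)) (summable_choose_mul_geometric_of_norm_lt_one (R := ℝ)
      (m + 1) (r := r) (by rwa [Real.norm_of_nonneg hr0]))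
  · intro k w x hw hx
    have h1 : ‖risingCoeff (w - 1) k‖ ≤ ((k + m).choose m : ℝ) := by
      refine norm_risingCoeff_le ?_ k
      have := norm_sub_le w 1
      rw [norm_one] at this
      linarith
    have h2 := hC k w (by linarith)
    -- The linear growth of `riemannZeta₁` is absorbed by raising the binomial coefficient by one.
    have h3 : ((k : ℝ) + 1) * ((k + m).choose m : ℝ)
        ≤ (m + 1) * ((k + (m + 1)).choose (m + 1) : ℝ) := by
      have := Nat.add_one_mul_choose_eq (k + m) m
      have h4 : ((k + m + 1 : ℕ) : ℝ) * ((k + m).choose m : ℝ)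
          = ((k + m + 1).choose (m + 1) : ℝ) * ((m + 1 : ℕ) : ℝ) := by exact_mod_cast this
      have h5 : (0 : ℝ) ≤ ((k + m).choose m : ℝ) := by positivity
      push_cast at h4
      rw [← add_assoc k m 1]
      nlinarith [mul_nonneg (show (0 : ℝ) ≤ m by positivity) h5]
    rw [norm_mul, norm_pow, zetaTaylor, norm_mul]
    calc ‖risingCoeff (w - 1) k‖ * ‖riemannZeta₁ (w + k)‖ * ‖x‖ ^ k
        ≤ ((k + m).choose m : ℝ) * (C * (k + 1)) * r ^ k := by gcongr
      _ = C * (((k : ℝ) + 1) * ((k + m).choose m : ℝ)) * r ^ k := by ring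
      _ ≤ C * ((m + 1) * ((k + (m + 1)).choose (m + 1) : ℝ)) * r ^ k := by gcongr
      _ = _ := by ring

/-- `∑ zetaTaylor w k * x ^ k`, equal to `(w - 1) ∑_{n ≥ 1} (n - x) ^ (-w)` for `1 < re w`. -/
noncomputable def hurwitzSeries (w x : ℂ) : ℂ := ∑' k, zetaTaylor w k * x ^ k

lemma summable_zetaTaylor (w : ℂ) {x : ℂ} (hx : ‖x‖ < 1) :
    Summable fun k => zetaTaylor w k * x ^ k := by
  obtain ⟨u, hu, h⟩ := exists_summable_zetaTaylor ‖w‖ (norm_nonneg x) hx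
  exact Summable.of_norm_bounded hu fun k => h k w x le_rfl le_rfl

lemma differentiable_hurwitzSeries {x : ℂ} (hx : ‖x‖ < 1) :
    Differentiable ℂ fun w => hurwitzSeries w x := by
  intro w
  obtain ⟨u, hu, h⟩ := exists_summable_zetaTaylor (‖w‖ + 1) (norm_nonneg x) hx
  have hd := differentiableOn_tsum_of_summable_norm (U := Metric.ball 0 (‖w‖ + 1)) hu
    (F := fun k w => zetaTaylor w k * x ^ k)
    (fun k => ((differentiable_zetaTaylor k).mul_const _).differentiableOn) Metric.isOpen_ball
    (fun k w hw => h k w x (by simpa using (mem_ball_zero_iff.mp hw).le) le_rfl)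
  exact hd.differentiableAt (Metric.isOpen_ball.mem_nhds (by simp))

lemma differentiableOn_hurwitzSeries (w : ℂ) :
    DifferentiableOn ℂ (hurwitzSeries w) (Metric.ball 0 1) := by
  intro x hx
  rw [mem_ball_zero_iff] at hx
  obtain ⟨r, hxr, hr⟩ := exists_between hx
  obtain ⟨u, hu, h⟩ := exists_summable_zetaTaylor ‖w‖ ((norm_nonneg x).trans hxr.le) hr
  have hd := differentiableOn_tsum_of_summable_norm (U := Metric.ball 0 r) hu
    (F := fun k x => zetaTaylor w k * x ^ k)
    (fun k => by fun_prop) Metric.isOpen_ball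
    (fun k x hx => h k w x le_rfl (by simpa using (mem_ball_zero_iff.mp hx).le))
  exact (hd.differentiableAt (Metric.isOpen_ball.mem_nhds
    (by simpa using hxr))).differentiableWithinAt

lemma natCast_add_one_sub_cpow (n : ℕ) {x : ℝ} (hx : |x| < 1) (w : ℂ) :
    ((n + 1 - x : ℝ) : ℂ) ^ (-w)
      = ((n + 1 : ℕ) : ℂ) ^ (-w) * (1 - (x / (n + 1 : ℕ) : ℝ) : ℂ) ^ (-w) := by
  have hx' := abs_lt.mp hx
  have hn : (0 : ℝ) < ((n + 1 : ℕ) : ℝ) := by positivity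
  have hn1 : (1 : ℝ) ≤ ((n + 1 : ℕ) : ℝ) := by push_cast; linarith [show (0 : ℝ) ≤ n by positivity]
  have h1 : (0 : ℝ) ≤ 1 - x / (n + 1 : ℕ) := by
    rw [sub_nonneg, div_le_one hn]
    linarith
  have := mul_cpow_ofReal_nonneg hn.le h1 (-w)
  rw [← ofReal_mul] at this
  have h2 : ((n + 1 : ℕ) : ℝ) * (1 - x / (n + 1 : ℕ)) = n + 1 - x := by
    field_simp
    push_cast
    ring
  rw [h2] at this
  rw [this]
  simp only [ofReal_sub, ofReal_one, ofReal_natCast]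

/-- Expand each (n+1-x)^(-w) by the binomial series. The double series converges absolutely, and
summing over n first yields ζ(w+k) as coefficient of x^k. -/
lemma hasSum_hurwitzSeries {w : ℂ} (hw : 1 < w.re) {x : ℝ} (hx : |x| < 1) :
    HasSum (fun n : ℕ => (w - 1) * ((n + 1 - x : ℝ) : ℂ) ^ (-w)) (hurwitzSeries w x) := by
  have hw1 : w - 1 ≠ 0 := by
    intro h
    rw [sub_eq_zero.mp h] at hw
    simp at hw
  let f : ℕ × ℕ → ℂ := fun p => risingCoeff w p.2 * (x : ℂ) ^ p.2 *
    ((p.1 + 1 : ℕ) : ℂ) ^ (-(w + p.2))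
  have hsx : Summable fun k => ‖risingCoeff w k * (x : ℂ) ^ k‖ :=
    (hasSum_risingCoeff w (y := x) (by simpa using hx)).summable.norm
  have hsn : Summable fun n : ℕ => (((n + 1 : ℕ) : ℝ)) ^ (-w.re) :=
    (summable_nat_add_iff 1).mpr (Real.summable_nat_rpow.mpr (by linarith))
  have hf : Summable f := by
    refine Summable.of_norm_bounded (hsn.mul_of_nonneg hsx (fun n => by positivity)
      fun k => norm_nonneg _) fun p => ?_
    have hpos : (0 : ℝ) < ((p.1 + 1 : ℕ) : ℝ) := by positivity
    have h1 : (1 : ℝ) ≤ ((p.1 + 1 : ℕ) : ℝ) := by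
      push_cast; linarith [show (0 : ℝ) ≤ p.1 by positivity]
    have h2 : ‖((p.1 + 1 : ℕ) : ℂ) ^ (-(w + p.2))‖ ≤ ((p.1 + 1 : ℕ) : ℝ) ^ (-w.re) := by
      rw [← ofReal_natCast, norm_cpow_eq_rpow_re_of_pos hpos]
      apply Real.rpow_le_rpow_of_exponent_le h1
      simp
    rw [norm_mul, mul_comm]
    gcongr
  have hn : ∀ n : ℕ, HasSum (fun k => f (n, k)) (((n + 1 - x : ℝ) : ℂ) ^ (-w)) := by
    intro n
    have hn0 : ((n + 1 : ℕ) : ℂ) ≠ 0 := by exact_mod_cast n.succ_ne_zero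
    have hpos : (0 : ℝ) < ((n + 1 : ℕ) : ℝ) := by positivity
    have hy : ‖((x / (n + 1 : ℕ) : ℝ) : ℂ)‖ < 1 := by
      rw [norm_real, Real.norm_eq_abs, abs_div, Nat.abs_cast, div_lt_one hpos]
      have : (1 : ℝ) ≤ ((n + 1 : ℕ) : ℝ) := by
        push_cast; linarith [show (0 : ℝ) ≤ n by positivity]
      linarith
    rw [natCast_add_one_sub_cpow n hx w]
    refine ((hasSum_risingCoeff w hy).mul_left (((n + 1 : ℕ) : ℂ) ^ (-w))).congr_fun fun k => ?_
    simp only [f]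
    rw [neg_add, cpow_add _ _ hn0, cpow_neg _ (k : ℂ), cpow_natCast]
    push_cast
    rw [div_pow]
    field_simp
  have hk : ∀ k : ℕ, HasSum (fun n => f (n, k))
      (risingCoeff w k * (x : ℂ) ^ k * riemannZeta (w + k)) := by
    intro k
    have hre : 1 < (w + k).re := by
      simp; linarith [show (0 : ℝ) ≤ k by positivity]
    suffices h : HasSum (fun n : ℕ => ((n + 1 : ℕ) : ℂ) ^ (-(w + k))) (riemannZeta (w + k)) from
      h.mul_left (risingCoeff w k * (x : ℂ) ^ k)
    have hs : Summable fun n : ℕ => 1 / (n : ℂ) ^ (w + k) := summable_one_div_nat_cpow.mpr hre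
    have hs1 := (summable_nat_add_iff 1).mpr hs
    rw [zeta_eq_tsum_one_div_nat_add_one_cpow hre]
    have := hs1.hasSum
    simp only [Nat.cast_add, Nat.cast_one] at this
    refine this.congr_fun fun n => ?_
    rw [cpow_neg, one_div]
    push_cast
    rfl
  clear_value f
  have h1 := hf.hasSum.prod_fiberwise hn
  have h2 := (((Equiv.prodComm ℕ ℕ).hasSum_iff (f := f)).mpr hf.hasSum).prod_fiberwise hk
  have h3 : hurwitzSeries w x = (w - 1) * ∑' p, f p := by
    rw [← h2.tsum_eq, ← tsum_mul_left, hurwitzSeries]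
    refine tsum_congr fun k => ?_
    rw [zetaTaylor_eq]
    · ring
    · intro h
      have := congrArg re h
      simp at this
      linarith [show (0 : ℝ) ≤ k by positivity]
  rw [h3]
  exact h1.mul_left _

end ZetaSeries

/-! ### Even Hurwitz zeta: expansion at 0, distribution relation, integral -/

section HurwitzContinuation

open Complex HurwitzZeta

lemma eq_of_eq_of_lt_re {f g : ℂ → ℂ} (hf : ∀ w, w ≠ 1 → DifferentiableAt ℂ f w)
    (hg : ∀ w, w ≠ 1 → DifferentiableAt ℂ g w) {b : ℝ} (hb : 1 ≤ b)
    (h : ∀ w : ℂ, b < w.re → f w = g w) {w : ℂ} (hw : w ≠ 1) : f w = g w := by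
  have hU : IsOpen ({1}ᶜ : Set ℂ) := isOpen_compl_singleton
  have hf' : AnalyticOnNhd ℂ f {1}ᶜ := DifferentiableOn.analyticOnNhd
    (fun z hz => (hf z hz).differentiableWithinAt) hU
  have hg' : AnalyticOnNhd ℂ g {1}ᶜ := DifferentiableOn.analyticOnNhd
    (fun z hz => (hg z hz).differentiableWithinAt) hU
  have hconn : IsPreconnected ({1}ᶜ : Set ℂ) :=
    (isConnected_compl_singleton_of_one_lt_rank (by simp) 1).isPreconnected
  have hmem : ((b + 1 : ℝ) : ℂ) ∈ ({1}ᶜ : Set ℂ) := by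
    simp only [Set.mem_compl_iff, Set.mem_singleton_iff, ofReal_eq_one]
    linarith
  refine hf'.eqOn_of_preconnected_of_eventuallyEq hg' hconn hmem ?_ hw
  filter_upwards [(isOpen_lt continuous_const continuous_re).mem_nhds
    (show b < ((b + 1 : ℝ) : ℂ).re by simp)] with z hz using h z hz

lemma cpow_neg_differentiable {y : ℂ} (hy : y ≠ 0) : Differentiable ℂ fun w : ℂ => y ^ (-w) :=
  fun _ => (differentiableAt_neg_iff.mpr differentiableAt_id).const_cpow (Or.inl hy)

/-- The sum over ℤ splits into the terms (n+x)^(-w) and (n+1-x)^(-w), n ≥ 0. Isolating x^(-w), the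
only one singular at 0, leaves the series at -x and at x. -/
lemma two_mul_hurwitzZetaEven_of_one_lt_re {w : ℂ} (hw : 1 < w.re) {x : ℝ} (hx0 : 0 < x)
    (hx1 : x < 1) : (w - 1) * (2 * hurwitzZetaEven x w)
      = (w - 1) * (x : ℂ) ^ (-w) + (hurwitzSeries w x + hurwitzSeries w (-x)) := by
  have hA := hasSum_hurwitzSeries hw (x := x) (by rw [abs_of_pos hx0]; exact hx1)
  have hB := hasSum_hurwitzSeries hw (x := -x) (by rw [abs_neg, abs_of_pos hx0]; exact hx1)
  have hC : HasSum (fun n : ℕ => (w - 1) * ((n + x : ℝ) : ℂ) ^ (-w))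
      (hurwitzSeries w (-x) + (w - 1) * (x : ℂ) ^ (-w)) := by
    have h : HasSum (fun n : ℕ => (w - 1) * (((n + 1 : ℕ) + x : ℝ) : ℂ) ^ (-w))
        (hurwitzSeries w (-x)) := by
      rw [ofReal_neg] at hB
      refine hB.congr_fun fun n => ?_
      congr 3
      push_cast
      ring
    have h2 := (hasSum_nat_add_iff (f := fun n : ℕ => (w - 1) * ((n + x : ℝ) : ℂ) ^ (-w)) 1).mp h
    simpa using h2
  have hE := ((hasSum_nat_hurwitzZetaEven_of_mem_Icc (a := x) ⟨hx0.le, hx1.le⟩ hw).mul_left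
    (2 * (w - 1)))
  have hS := (hC.add hA).congr_fun (g := fun n : ℕ => 2 * (w - 1) *
    ((1 / (n + x : ℂ) ^ w + 1 / (n + 1 - x : ℂ) ^ w) / 2)) fun n => by
      rw [cpow_neg, cpow_neg]
      push_cast
      ring
  have := hE.unique hS
  linear_combination this

/-- Expansion of the even Hurwitz zeta function around `x = 0`. -/
theorem two_mul_hurwitzZetaEven {w : ℂ} (hw : w ≠ 1) {x : ℝ} (hx0 : 0 < x) (hx1 : x < 1) :
    2 * hurwitzZetaEven x w
      = (x : ℂ) ^ (-w) + (w - 1)⁻¹ * (hurwitzSeries w x + hurwitzSeries w (-x)) := by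
  have hn : ‖(x : ℂ)‖ < 1 := by simpa [abs_of_pos hx0] using hx1
  have key := eq_of_eq_of_lt_re (b := 1) (w := w)
    (f := fun w => (w - 1) * (2 * hurwitzZetaEven x w))
    (g := fun w => (w - 1) * (x : ℂ) ^ (-w) + (hurwitzSeries w x + hurwitzSeries w (-x)))
    (fun w hw => (differentiableAt_id.sub_const 1).mul
      ((differentiableAt_hurwitzZetaEven x hw).const_mul 2))
    (fun w _ => ((differentiableAt_id.sub_const 1).mul
      (cpow_neg_differentiable (by exact_mod_cast hx0.ne') w)).add
      ((differentiable_hurwitzSeries hn w).add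
        (differentiable_hurwitzSeries (by rwa [norm_neg]) w))) le_rfl
    (fun w hw => two_mul_hurwitzZetaEven_of_one_lt_re hw hx0 hx1) hw
  have h1 : w - 1 ≠ 0 := sub_ne_zero.mpr hw
  field_simp
  linear_combination key

lemma hurwitzSeries_zero {w : ℂ} (hw : w ≠ 1) : hurwitzSeries w 0 = (w - 1) * riemannZeta w := by
  rw [hurwitzSeries, tsum_eq_single 0 (fun k hk => by simp [hk]), zetaTaylor_eq (by simpa using hw)]
  simp [risingCoeff]

/-- Every integer is nN + k for a unique residue k, and |nN + k| = N |n + k/N|. The term of the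
integer 0 is zero on both sides by convention. -/
lemma sum_hurwitzZetaEven_of_one_lt_re {N : ℕ} (hN : N ≠ 0) {w : ℂ} (hw : 1 < w.re) :
    ∑ k ∈ Finset.range N, hurwitzZetaEven ((k / N : ℝ) : UnitAddCircle) w
      = (N : ℂ) ^ w * riemannZeta w := by
  have : NeZero N := ⟨hN⟩
  have hNpos : (0 : ℝ) < N := by exact_mod_cast Nat.pos_of_ne_zero hN
  have hN0 : (N : ℂ) ≠ 0 := by exact_mod_cast hN
  have h := hasSum_int_hurwitzZetaEven 0 hw
  rw [show (((0 : ℝ)) : UnitAddCircle) = 0 from rfl, hurwitzZetaEven_zero] at h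
  have h1 := ((Int.divModEquiv N).symm.hasSum_iff.mpr h)
  have h2 := ((Equiv.prodComm (Fin N) ℤ).hasSum_iff.mpr h1)
  have hterm : ∀ k : Fin N, HasSum (fun n : ℤ =>
      (N : ℂ) ^ (-w) * (1 / ((|n + ((k : ℕ) / N : ℝ)| : ℝ) : ℂ) ^ w / 2))
      ((N : ℂ) ^ (-w) * hurwitzZetaEven (((k : ℕ) / N : ℝ) : UnitAddCircle) w) := fun k =>
    (hasSum_int_hurwitzZetaEven _ hw).mul_left _
  have h3 := h2.prod_fiberwise (g := fun k : Fin N => (N : ℂ) ^ (-w) *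
    hurwitzZetaEven (((k : ℕ) / N : ℝ) : UnitAddCircle) w) fun k => by
    refine (hterm k).congr_fun fun n => ?_
    simp only [Function.comp_apply, Equiv.prodComm_apply, Prod.swap_prod_mk,
      Int.divModEquiv_symm_apply, add_zero]
    have e : |((n * N + (k : ℕ) : ℤ) : ℝ)| = N * |(n : ℝ) + ((k : ℕ) / N : ℝ)| := by
      rw [← abs_of_pos hNpos, ← abs_mul, abs_of_pos hNpos]
      congr 1
      push_cast
      field_simp
    push_cast at e ⊢
    rw [e, ofReal_mul, mul_cpow_ofReal_nonneg hNpos.le (abs_nonneg _), cpow_neg, ofReal_natCast]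
    field_simp
  have h4 := h3.unique (hasSum_fintype _)
  rw [h4, Finset.sum_range, ← Finset.mul_sum, ← mul_assoc, ← cpow_add _ _ hN0]
  simp

/-- The distribution relation for the even Hurwitz zeta function. -/
theorem sum_hurwitzZetaEven {N : ℕ} (hN : N ≠ 0) {w : ℂ} (hw : w ≠ 1) :
    ∑ k ∈ Finset.range N, hurwitzZetaEven ((k / N : ℝ) : UnitAddCircle) w
      = (N : ℂ) ^ w * riemannZeta w := by
  refine eq_of_eq_of_lt_re (b := 1)
    (f := fun w => ∑ k ∈ Finset.range N, hurwitzZetaEven ((k / N : ℝ) : UnitAddCircle) w)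
    (fun w hw => ?_) (fun w hw => ?_) le_rfl
    (fun w hw => sum_hurwitzZetaEven_of_one_lt_re hN hw) hw
  · exact DifferentiableAt.fun_sum fun k _ => differentiableAt_hurwitzZetaEven _ hw
  · exact (differentiableAt_id.const_cpow (Or.inl (by exact_mod_cast hN))).mul
      (differentiableAt_riemannZeta hw)

/-- The primitive of `hurwitzSeries w` in `x`. -/
noncomputable def hurwitzPrimitive (w x : ℂ) : ℂ := ∑' k, zetaTaylor w k * (x ^ (k + 1) / (k + 1))

lemma norm_pow_succ_div_le {x : ℂ} (hx : ‖x‖ < 1) (k : ℕ) :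
    ‖x ^ (k + 1) / ((k : ℂ) + 1)‖ ≤ ‖x‖ ^ k := by
  have h1 : ‖(k : ℂ) + 1‖ = (k : ℝ) + 1 := by
    rw [← Nat.cast_add_one, norm_natCast]; push_cast; rfl
  rw [norm_div, norm_pow, h1, div_le_iff₀ (by positivity), pow_succ]
  have : (0 : ℝ) ≤ k := by positivity
  exact mul_le_mul_of_nonneg_left (by linarith) (by positivity)

lemma differentiable_hurwitzPrimitive {x : ℂ} (hx : ‖x‖ < 1) :
    Differentiable ℂ fun w => hurwitzPrimitive w x := by
  intro w
  obtain ⟨u, hu, h⟩ := exists_summable_zetaTaylor (‖w‖ + 1) (norm_nonneg x) hx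
  have hd := differentiableOn_tsum_of_summable_norm (U := Metric.ball 0 (‖w‖ + 1)) hu
    (F := fun k w => zetaTaylor w k * (x ^ (k + 1) / (k + 1)))
    (fun k => ((differentiable_zetaTaylor k).mul_const _).differentiableOn) Metric.isOpen_ball
    (fun k w hw => by
      refine le_trans ?_ (h k w x (by simpa using (mem_ball_zero_iff.mp hw).le) le_rfl)
      rw [norm_mul, norm_mul, norm_pow]
      exact mul_le_mul_of_nonneg_left (norm_pow_succ_div_le hx k) (norm_nonneg _))
  exact hd.differentiableAt (Metric.isOpen_ball.mem_nhds (by simp))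

/-- Formally, (w-1)(n-x)^(-w) has primitive (n-x)^(1-w), and summing these gives the series at w -
1. The proof compares Taylor coefficients. -/
lemma hurwitzPrimitive_eq {w : ℂ} (hw : 2 < w.re) {x : ℂ} (hx : ‖x‖ < 1) :
    hurwitzPrimitive w x = (w - 2)⁻¹ * (hurwitzSeries (w - 1) x - hurwitzSeries (w - 1) 0) := by
  have hne : ∀ k : ℕ, w - 1 + k ≠ 1 := by
    intro k h
    have := congrArg re h
    simp at this
    linarith [show (0 : ℝ) ≤ k by positivity]
  have h2 : w - 2 ≠ 0 := by
    intro h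
    have := congrArg re h
    simp at this
    linarith
  have hs := (summable_zetaTaylor (w - 1) hx).hasSum
  have hs1 := (hasSum_nat_add_iff' 1).mpr hs
  have h0 : hurwitzSeries (w - 1) 0 = zetaTaylor (w - 1) 0 := by
    rw [hurwitzSeries, tsum_eq_single 0 (fun k hk => by simp [hk])]
    simp
  rw [hurwitzPrimitive, eq_inv_mul_iff_mul_eq₀ h2, ← tsum_mul_left, h0]
  simp only [Finset.range_one, Finset.sum_singleton, pow_zero, mul_one] at hs1
  rw [hurwitzSeries, ← hs1.tsum_eq]
  refine tsum_congr fun k => ?_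
  have hk : (k : ℂ) + 1 ≠ 0 := by exact_mod_cast k.succ_ne_zero
  have hne' := hne (k + 1)
  have e := risingCoeff_succ (w - 1) k
  rw [zetaTaylor_eq hne', zetaTaylor, riemannZeta_eq_inv_sub_mul hne']
  have hz : w - 1 + ((k + 1 : ℕ) : ℂ) - 1 ≠ 0 := sub_ne_zero.mpr hne'
  have hz' : w - 1 + ((k + 1 : ℕ) : ℂ) = w + k := by push_cast; ring
  rw [hz'] at hz ⊢
  have hr : risingCoeff (w - 1) (k + 1) = (w - 1 + k) * risingCoeff (w - 1) k / (k + 1) := by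
    field_simp
    linear_combination e
  rw [hr, show w - 1 + k = w + k - 1 by ring]
  field_simp
  ring

/-- For Re w > 2 the difference telescopes, since n + 1/2 and (n+1) - 1/2 agree: only (1/2)^(1-w)
remains. Both sides are entire in w, which gives the general case. -/
lemma hurwitzPrimitive_half (w : ℂ) :
    hurwitzPrimitive w (1 / 2) - hurwitzPrimitive w (-(1 / 2)) = (2 : ℂ) ^ (w - 1) := by
  have hn : ‖(1 / 2 : ℂ)‖ < 1 := by norm_num
  have hn' : ‖(-(1 / 2) : ℂ)‖ < 1 := by norm_num
  have hlarge : ∀ w : ℂ, 2 < w.re →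
      hurwitzPrimitive w (1 / 2) - hurwitzPrimitive w (-(1 / 2)) = (2 : ℂ) ^ (w - 1) := by
    intro w hw
    have h2 : w - 2 ≠ 0 := by
      intro h
      have := congrArg re h
      simp at this
      linarith
    have hw1 : 1 < (w - 1).re := by simp; linarith
    rw [hurwitzPrimitive_eq hw hn, hurwitzPrimitive_eq hw hn', ← mul_sub,
      sub_sub_sub_cancel_right]
    have hA := hasSum_hurwitzSeries hw1 (x := 1 / 2) (by norm_num [abs_of_pos])
    have hB := hasSum_hurwitzSeries hw1 (x := -(1 / 2)) (by norm_num [abs_of_pos])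
    have hB' := (hasSum_nat_add_iff' 1).mpr hA
    have hu := hB'.unique (hB.congr_fun fun n => by
      congr 3
      push_cast
      ring)
    simp only [Finset.range_one, Finset.sum_singleton, Nat.cast_zero, zero_add] at hu
    rw [show (((1 / 2 : ℝ)) : ℂ) = 1 / 2 by norm_num,
      show (((-(1 / 2) : ℝ)) : ℂ) = -(1 / 2) by norm_num] at hu
    rw [show ((1 - 1 / 2 : ℝ) : ℂ) = (2 : ℂ)⁻¹ by norm_num] at hu
    have harg : arg (2 : ℂ) ≠ Real.pi := by
      have := arg_ofReal_of_nonneg (x := 2) zero_le_two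
      rw [ofReal_ofNat] at this
      rw [this]
      exact Real.pi_pos.ne
    have hinv : ((2 : ℂ)⁻¹) ^ (-(w - 1)) = (2 : ℂ) ^ (w - 1) := by
      rw [inv_cpow _ _ harg, cpow_neg, inv_inv]
    rw [hinv] at hu
    rw [inv_mul_eq_iff_eq_mul₀ h2]
    linear_combination hu
  have hd : Differentiable ℂ fun w : ℂ => hurwitzPrimitive w (1 / 2)
      - hurwitzPrimitive w (-(1 / 2)) :=
    (differentiable_hurwitzPrimitive hn).sub (differentiable_hurwitzPrimitive hn')
  have hg : Differentiable ℂ fun w : ℂ => (2 : ℂ) ^ (w - 1) := fun w =>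
    (differentiableAt_id.sub_const 1).const_cpow (Or.inl two_ne_zero)
  have hev : (fun w : ℂ => hurwitzPrimitive w (1 / 2) - hurwitzPrimitive w (-(1 / 2)))
      =ᶠ[nhds 3] fun w => (2 : ℂ) ^ (w - 1) := by
    filter_upwards [(isOpen_lt continuous_const continuous_re).mem_nhds
      (show (2 : ℝ) < (3 : ℂ).re by norm_num)] with z hz using hlarge z hz
  exact congrFun (AnalyticOnNhd.eq_of_eventuallyEq
    (fun z _ => hd.analyticAt z) (fun z _ => hg.analyticAt z) hev) w

/-- The integral is the difference of the primitive at 1/2 and -1/2. Divided by w - 1, it cancels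
the continuation of ∫ x^(-w) dx over (0, 1/2), which is 2^(w-1)/(1-w): the periodic zeta function
has regularized mean zero. -/
lemma integral_hurwitzSeries (w : ℂ) :
    ∫ x in (0 : ℝ)..(1 / 2), (hurwitzSeries w x + hurwitzSeries w (-x)) = (2 : ℂ) ^ (w - 1) := by
  have hball : ∀ x : ℝ, x ∈ Set.uIcc (0 : ℝ) (1 / 2) → ‖(x : ℂ)‖ < 1 := by
    intro x hx
    rw [Set.uIcc_of_le (by norm_num)] at hx
    rw [norm_real, Real.norm_eq_abs, abs_of_nonneg hx.1]
    linarith [hx.2]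
  have hderiv : ∀ x : ℂ, ‖x‖ < 1 → HasDerivAt (hurwitzPrimitive w) (hurwitzSeries w x) x := by
    intro x hx
    obtain ⟨r, hxr, hr⟩ := exists_between hx
    obtain ⟨u, hu, h⟩ := exists_summable_zetaTaylor ‖w‖ ((norm_nonneg x).trans hxr.le) hr
    have hu' : ∀ (k : ℕ) (y : ℂ), y ∈ Metric.ball (0 : ℂ) r →
        ‖zetaTaylor w k * (y ^ (k + 1) / (k + 1))‖ ≤ u k := by
      intro k y hy
      have hyr : ‖y‖ < r := mem_ball_zero_iff.mp hy
      refine le_trans ?_ (h k w y le_rfl hyr.le)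
      rw [norm_mul, norm_mul, norm_pow]
      exact mul_le_mul_of_nonneg_left (norm_pow_succ_div_le (hyr.trans hr) k) (norm_nonneg _)
    have hmem : x ∈ Metric.ball (0 : ℂ) r := by simpa using hxr
    have hterm : ∀ (k : ℕ) (y : ℂ), HasDerivAt (fun y : ℂ => zetaTaylor w k * (y ^ (k + 1) / (k + 1)))
        (zetaTaylor w k * y ^ k) y := by
      intro k y
      have hk : (k : ℂ) + 1 ≠ 0 := by exact_mod_cast k.succ_ne_zero
      refine (((hasDerivAt_pow (k + 1) y).div_const ((k : ℂ) + 1)).const_mul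
        (zetaTaylor w k)).congr_deriv ?_
      simp only [Nat.add_sub_cancel]
      push_cast
      field_simp
    have hdiff : DifferentiableOn ℂ (hurwitzPrimitive w) (Metric.ball 0 r) :=
      differentiableOn_tsum_of_summable_norm hu
        (fun k y _ => (hterm k y).differentiableAt.differentiableWithinAt) Metric.isOpen_ball hu'
    have hsum := hasSum_deriv_of_summable_norm hu
      (fun k y _ => (hterm k y).differentiableAt.differentiableWithinAt) Metric.isOpen_ball hu' hmem
    have h1 := (hdiff.differentiableAt (Metric.isOpen_ball.mem_nhds hmem)).hasDerivAt
    refine h1.congr_deriv ?_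
    rw [hurwitzSeries]
    refine (hsum.tsum_eq.symm.trans ?_)
    exact tsum_congr fun k => (hterm k x).deriv
  have hF : ∀ x ∈ Set.uIcc (0 : ℝ) (1 / 2), HasDerivAt
      (fun x : ℝ => hurwitzPrimitive w x - hurwitzPrimitive w (-x))
      (hurwitzSeries w x + hurwitzSeries w (-x)) x := by
    intro x hx
    have h1 := (hderiv x (hball x hx)).comp_ofReal
    have h2 : HasDerivAt (fun z : ℂ => hurwitzPrimitive w (-z)) (-hurwitzSeries w (-x)) (x : ℂ) := by
      have := (hderiv (-x) (by rw [norm_neg]; exact hball x hx)).scomp (x : ℂ) (hasDerivAt_neg (x : ℂ))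
      exact this.congr_deriv (by simp)
    refine (h1.sub h2.comp_ofReal).congr_deriv ?_
    ring
  have hcont : ContinuousOn (fun x : ℝ => hurwitzSeries w x + hurwitzSeries w (-x))
      (Set.uIcc (0 : ℝ) (1 / 2)) := by
    have hc := (differentiableOn_hurwitzSeries w).continuousOn
    refine ContinuousOn.add ?_ ?_
    · exact hc.comp continuous_ofReal.continuousOn fun x hx => by
        simpa using hball x hx
    · exact hc.comp (continuous_ofReal.neg.continuousOn) fun x hx => by
        simpa using hball x hx
  rw [intervalIntegral.integral_eq_sub_of_hasDerivAt hF hcont.intervalIntegrable,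
    ← hurwitzPrimitive_half w]
  norm_num

end HurwitzContinuation

/-! ### Powers of the sinc function and their Taylor coefficients -/

section Csinc

open Complex

lemma csinc_neg (z : ℂ) : csinc (-z) = csinc z := by
  by_cases h : z = 0
  · simp [h]
  · simp [csinc, h, mul_neg, sin_neg]

lemma differentiable_csinc : Differentiable ℂ csinc := by
  have hpi : (Real.pi : ℂ) ≠ 0 := by exact_mod_cast Real.pi_ne_zero
  let f : ℂ → ℂ := fun z => sin (Real.pi * z) / Real.pi
  have hf : ∀ z, HasDerivAt f (cos (Real.pi * z)) z := by
    intro z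
    have h1 : HasDerivAt (fun z : ℂ => (Real.pi : ℂ) * z) (Real.pi : ℂ) z := by
      simpa using (hasDerivAt_id z).const_mul (Real.pi : ℂ)
    refine ((h1.csin).div_const (Real.pi : ℂ)).congr_deriv ?_
    field_simp
  -- The sinc function is the difference quotient at 0 of sin(πz)/π, so its singularity there is
  -- removable.
  have heq : csinc = dslope f 0 := by
    ext z
    by_cases hz : z = 0
    · subst hz
      rw [dslope_same, (hf 0).deriv]
      simp [csinc]
    · rw [dslope_of_ne _ hz, slope_def_field]
      simp [csinc, hz, f]
      field_simp
  rw [heq, ← differentiableOn_univ, differentiableOn_dslope univ_mem]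
  exact fun z _ => (hf z).differentiableAt.differentiableWithinAt

lemma hasSum_csinc (z : ℂ) :
    HasSum (fun n : ℕ => (-1) ^ n * (Real.pi * z) ^ (2 * n) / ((2 * n + 1).factorial : ℂ))
      (csinc z) := by
  have hpi : (Real.pi : ℂ) ≠ 0 := by exact_mod_cast Real.pi_ne_zero
  by_cases hz : z = 0
  · subst hz
    have := hasSum_single (f := fun n : ℕ =>
      (-1) ^ n * ((Real.pi : ℂ) * 0) ^ (2 * n) / ((2 * n + 1).factorial : ℂ)) 0
      (fun n hn => by simp [hn])
    simpa [csinc] using this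
  · have h := (hasSum_sin (Real.pi * z)).div_const ((Real.pi : ℂ) * z)
    rw [csinc, if_neg hz]
    refine h.congr_fun fun n => ?_
    rw [pow_succ]
    field_simp

/-- The radius 3/5 exceeds 1/2, so half a period is covered. There |πz|² ≤ 3.6 and (2n+3)! ≥ 6·20^n,
so the series without its first term is dominated by ∑ 0.6·0.18^n < 1. -/
lemma norm_csinc_sub_one_lt {z : ℂ} (hz : ‖z‖ ≤ 3 / 5) : ‖csinc z - 1‖ < 1 := by
  have h := (hasSum_nat_add_iff' 1).mpr (hasSum_csinc z)
  simp only [Finset.range_one, Finset.sum_singleton, pow_zero, mul_zero, zero_add,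
    Nat.factorial_one, Nat.cast_one, div_one, mul_one] at h
  set y : ℝ := ‖(Real.pi : ℂ) * z‖ with hy
  have hy0 : 0 ≤ y := norm_nonneg _
  have hy2 : y ^ 2 ≤ 3.6 := by
    have h1 : y = Real.pi * ‖z‖ := by
      rw [hy, norm_mul, norm_real, Real.norm_of_nonneg Real.pi_pos.le]
    have h2 : y ≤ 3.1416 * (3 / 5) := by
      rw [h1]
      exact mul_le_mul Real.pi_lt_d4.le hz (norm_nonneg _) (by norm_num)
    nlinarith
  have hfac : ∀ n : ℕ, (6 * 20 ^ n : ℝ) ≤ ((2 * (n + 1) + 1).factorial : ℝ) := by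
    intro n
    induction n with
    | zero => norm_num [Nat.factorial]
    | succ n ih =>
      have : (2 * (n + 1 + 1) + 1).factorial
          = (2 * n + 5) * ((2 * n + 4) * (2 * (n + 1) + 1).factorial) := by
        rw [show 2 * (n + 1 + 1) + 1 = (2 * n + 4) + 1 by ring, Nat.factorial_succ,
          show 2 * n + 4 = (2 * (n + 1) + 1) + 1 by ring, Nat.factorial_succ]
        ring
      rw [this, pow_succ]
      push_cast at ih ⊢
      have hn : (0 : ℝ) ≤ n := by positivity
      have h3 : (20 : ℝ) ≤ (2 * n + 5) * (2 * n + 4) := by nlinarith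
      calc (6 * (20 ^ n * 20) : ℝ) = 20 * (6 * 20 ^ n) := by ring
        _ ≤ ((2 * n + 5) * (2 * n + 4)) * ((2 * (n + 1) + 1).factorial : ℝ) := by gcongr
        _ = _ := by ring
  have hg : HasSum (fun n : ℕ => (0.6 : ℝ) * 0.18 ^ n) (0.6 * (1 - 0.18)⁻¹) :=
    (hasSum_geometric_of_lt_one (by norm_num) (by norm_num)).mul_left _
  refine lt_of_le_of_lt (h.norm_le_of_bounded hg fun n => ?_) (by norm_num)
  rw [norm_div, norm_mul, norm_pow, norm_neg, norm_one, one_pow, one_mul, norm_pow,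
    Complex.norm_natCast,
    ← hy, div_le_iff₀ (by exact_mod_cast Nat.factorial_pos _)]
  calc y ^ (2 * (n + 1)) = (y ^ 2) ^ (n + 1) := by rw [pow_mul]
    _ ≤ 3.6 ^ (n + 1) := by gcongr
    _ = 0.6 * 0.18 ^ n * (6 * 20 ^ n) := by
        rw [show (3.6 : ℝ) = 0.18 * 20 by norm_num, mul_pow, pow_succ, pow_succ]
        ring
    _ ≤ _ := by gcongr; exact hfac n

lemma csinc_mem_slitPlane {z : ℂ} (hz : ‖z‖ ≤ 3 / 5) : csinc z ∈ slitPlane := by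
  have := mem_slitPlane_of_norm_lt_one (norm_csinc_sub_one_lt hz)
  simpa using this

lemma csinc_ne_zero {z : ℂ} (hz : ‖z‖ ≤ 3 / 5) : csinc z ≠ 0 :=
  slitPlane_ne_zero (csinc_mem_slitPlane hz)

lemma differentiableOn_csinc_cpow (s : ℂ) :
    DifferentiableOn ℂ (fun z => csinc z ^ (-s)) (Metric.ball 0 (3 / 5)) := fun z hz =>
  ((differentiable_csinc z).cpow_const
    (csinc_mem_slitPlane (mem_ball_zero_iff.mp hz).le)).differentiableWithinAt

lemma iteratedDeriv_csinc_cpow_odd (s : ℂ) {k : ℕ} (hk : Odd k) :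
    iteratedDeriv k (fun z => csinc z ^ (-s)) 0 = 0 := by
  have h := iteratedDeriv_comp_neg k (fun z => csinc z ^ (-s)) 0
  simp only [csinc_neg, hk.neg_one_pow, neg_zero, neg_smul, one_smul] at h
  linear_combination h / 2

lemma hasSum_alpha (s : ℂ) {z : ℂ} (hz : ‖z‖ < 3 / 5) :
    HasSum (fun n => alpha n s * z ^ (2 * n)) (csinc z ^ (-s)) := by
  have h := hasSum_taylorSeries_on_ball (differentiableOn_csinc_cpow s)
    (z := z) (by simpa using hz)
  have hinj : Function.Injective (fun n : ℕ => 2 * n) := fun a b hab => by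
    simpa using hab
  refine ((hinj.hasSum_iff fun k hk => ?_).mpr h).congr_fun fun n => ?_
  · have hodd : Odd k := by
      rw [← Nat.not_even_iff_odd]
      rintro ⟨m, hm⟩
      exact hk ⟨m, by simp only; omega⟩
    rw [iteratedDeriv_csinc_cpow_odd s hodd, smul_zero, smul_zero]
  · simp only [Function.comp_apply, sub_zero, smul_eq_mul, alpha]
    ring

/-- Cauchy's estimate on the circle of radius 11/20, chosen between 1/2 and 3/5. A bound for log
`csinc` makes it uniform for s in a disc. -/
lemma exists_norm_alpha_le (R : ℝ) :
    ∃ C : ℝ, 0 ≤ C ∧ ∀ (s : ℂ) (n : ℕ), ‖s‖ ≤ R → ‖alpha n s‖ ≤ C / (11 / 20) ^ (2 * n) := by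
  have hcont : ContinuousOn (fun z => log (csinc z)) (Metric.closedBall 0 (3 / 5)) :=
    differentiable_csinc.continuous.continuousOn.clog fun z hz =>
      csinc_mem_slitPlane (mem_closedBall_zero_iff.mp hz)
  obtain ⟨L, hL⟩ := (isCompact_closedBall (0 : ℂ) (3 / 5)).exists_bound_of_continuousOn hcont
  refine ⟨Real.exp (L * R), (Real.exp_pos _).le, fun s n hs => ?_⟩
  have hb : ∀ z ∈ Metric.sphere (0 : ℂ) (11 / 20), ‖csinc z ^ (-s)‖ ≤ Real.exp (L * R) := by
    intro z hz
    have hz' : ‖z‖ ≤ 3 / 5 := by rw [mem_sphere_zero_iff_norm.mp hz]; norm_num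
    rw [cpow_def_of_ne_zero (csinc_ne_zero hz')]
    refine (norm_exp_le_exp_norm _).trans (Real.exp_le_exp.mpr ?_)
    rw [norm_mul, norm_neg]
    have := hL z (by simpa using hz')
    exact mul_le_mul this hs (norm_nonneg _) ((norm_nonneg _).trans this)
  have hd : DiffContOnCl ℂ (fun z => csinc z ^ (-s)) (Metric.ball 0 (11 / 20)) :=
    ((differentiableOn_csinc_cpow s).mono
      (Metric.closedBall_subset_ball (by norm_num))).diffContOnCl_ball subset_rfl
  have h := norm_iteratedDeriv_le_of_forall_mem_sphere_norm_le (2 * n) (by norm_num) hd hb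
  have hf : (0 : ℝ) < ((2 * n).factorial : ℝ) := by exact_mod_cast Nat.factorial_pos _
  rw [alpha, norm_div, norm_natCast, div_le_iff₀ hf]
  refine h.trans_eq ?_
  ring

/-- Gives the dependence on s: each derivative is a polynomial in s times the exponential, so each
`alpha n` is a polynomial in s. -/
lemma iteratedDeriv_exp_mul {L : ℂ → ℂ} {U : Set ℂ} (hU : IsOpen U) (hL : DifferentiableOn ℂ L U)
    (n : ℕ) : ∃ (ι : Type) (_ : Fintype ι) (a : ι → ℂ → ℂ) (e : ι → ℕ),
      (∀ i, DifferentiableOn ℂ (a i) U) ∧ ∀ s, ∀ z ∈ U,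
        iteratedDeriv n (fun z => exp (s * L z)) z
          = (∑ i, a i z * s ^ e i) * exp (s * L z) := by
  induction n with
  | zero =>
    refine ⟨Unit, inferInstance, fun _ _ => 1, fun _ => 0, fun _ => differentiableOn_const _, ?_⟩
    simp
  | succ n ih =>
    obtain ⟨ι, hι, a, e, ha, h⟩ := ih
    refine ⟨ι ⊕ ι, inferInstance, Sum.elim (fun i => deriv (a i)) fun i z => a i z * deriv L z,
      Sum.elim e fun i => e i + 1, ?_, fun s z hz => ?_⟩
    · rintro (i | i)
      · exact (ha i).deriv hU
      · exact (ha i).mul (hL.deriv hU)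
    · have hev : iteratedDeriv n (fun z => exp (s * L z))
          =ᶠ[nhds z] fun z => (∑ i, a i z * s ^ e i) * exp (s * L z) := by
        filter_upwards [hU.mem_nhds hz] with y hy using h s y hy
      have hLz := (hL.differentiableAt (hU.mem_nhds hz)).hasDerivAt
      have h1 : HasDerivAt (fun z => ∑ i, a i z * s ^ e i) (∑ i, deriv (a i) z * s ^ e i) z :=
        HasDerivAt.fun_sum fun i _ =>
          (((ha i).differentiableAt (hU.mem_nhds hz)).hasDerivAt.mul_const _)
      have h2 := h1.mul (hLz.const_mul s).cexp
      rw [iteratedDeriv_succ, hev.deriv_eq]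
      refine h2.deriv.trans ?_
      rw [Fintype.sum_sum_type]
      simp only [Sum.elim_inl, Sum.elim_inr]
      rw [add_mul, add_right_inj]
      rw [mul_comm (exp _) _, ← mul_assoc, Finset.sum_mul]
      congr 1
      refine Finset.sum_congr rfl fun i _ => ?_
      ring

lemma differentiable_alpha (n : ℕ) : Differentiable ℂ (alpha n) := by
  have hL : DifferentiableOn ℂ (fun z => -log (csinc z)) (Metric.ball 0 (3 / 5)) := fun z hz =>
    ((differentiable_csinc z).clog
      (csinc_mem_slitPlane (mem_ball_zero_iff.mp hz).le)).neg.differentiableWithinAt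
  obtain ⟨ι, hι, a, e, -, h⟩ := iteratedDeriv_exp_mul Metric.isOpen_ball hL (2 * n)
  have h0 : (0 : ℂ) ∈ Metric.ball (0 : ℂ) (3 / 5) := by simp
  have hlog : log (csinc 0) = 0 := by simp [csinc]
  have heq : alpha n = fun s => (∑ i, a i 0 * s ^ e i) / ((2 * n).factorial : ℂ) := by
    ext s
    have hev : (fun z => csinc z ^ (-s)) =ᶠ[nhds 0] fun z => exp (s * -log (csinc z)) := by
      filter_upwards [Metric.isOpen_ball.mem_nhds h0] with z hz
      rw [cpow_def_of_ne_zero (csinc_ne_zero (mem_ball_zero_iff.mp hz).le)]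
      congr 1
      ring
    rw [alpha, hev.iteratedDeriv_eq, h s 0 h0, hlog]
    simp
  rw [heq]
  fun_prop

end Csinc

/-! ### The constant V_s as a Beta integral and as a series -/

section CircleConstant

open Complex MeasureTheory

/-- The terms of the series obtained by integrating the expansion of `|2 sin π x| ^ (-s)`. -/
noncomputable def circleTerm (s : ℂ) (n : ℕ) : ℂ :=
  alpha n s * ((2 : ℂ) ^ (s - 2 * n - 1) / (2 * n + 1 - s))

lemma half_cpow (z : ℂ) : ((1 / 2 : ℝ) : ℂ) ^ z = (2 : ℂ) ^ (-z) := by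
  have harg : arg (2 : ℂ) ≠ Real.pi := by
    have := arg_ofReal_of_nonneg (x := 2) zero_le_two
    rw [ofReal_ofNat] at this
    rw [this]
    exact Real.pi_pos.ne
  rw [show ((1 / 2 : ℝ) : ℂ) = (2 : ℂ)⁻¹ by norm_num, inv_cpow _ _ harg, cpow_neg]

/-- Termwise integration of the expansion of `x ^ (-s) * csinc x ^ (-s)` after removal of the
first terms. -/
lemma hasSum_integral_csinc_cpow {s : ℂ} {M : ℕ} (hs : s.re < 2 * M + 1) :
    HasSum (fun n => circleTerm s (n + M)) (∫ x in (0 : ℝ)..(1 / 2),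
      (x : ℂ) ^ (-s) * (csinc x ^ (-s) - ∑ n ∈ Finset.range M, alpha n s * (x : ℂ) ^ (2 * n))) := by
  obtain ⟨C, hC0, hC⟩ := exists_norm_alpha_le ‖s‖
  have hre : ∀ n : ℕ, (-1 : ℝ) < (2 * ((n + M : ℕ) : ℂ) - s).re := by
    intro n
    have : (0 : ℝ) ≤ n := by positivity
    simp
    linarith
  -- On (0, 1/2] consecutive terms are bounded with ratio ((1/2)/(11/20))² = 100/121.
  set D : ℝ := C / (11 / 20) ^ (2 * M)
  have hD0 : 0 ≤ D := by positivity
  have hIoc : Set.uIoc (0 : ℝ) (1 / 2) = Set.Ioc 0 (1 / 2) := Set.uIoc_of_le (by norm_num)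
  have key := intervalIntegral.hasSum_integral_of_dominated_convergence (μ := volume)
    (a := (0 : ℝ)) (b := 1 / 2)
    (F := fun (n : ℕ) (t : ℝ) => alpha (n + M) s * (t : ℂ) ^ (2 * ((n + M : ℕ) : ℂ) - s))
    (f := fun x : ℝ => (x : ℂ) ^ (-s) * (csinc x ^ (-s)
      - ∑ n ∈ Finset.range M, alpha n s * (x : ℂ) ^ (2 * n)))
    (fun n t => D * t ^ (2 * M - s.re) * (100 / 121) ^ n) ?_ ?_ ?_ ?_ ?_
  · refine key.congr_fun fun n => ?_
    have h1 : (2 * ((n + M : ℕ) : ℂ) - s + 1) ≠ 0 := by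
      intro h
      have h2 := hre n
      have := congrArg re h
      rw [add_re, one_re, zero_re] at this
      linarith
    rw [circleTerm, intervalIntegral.integral_const_mul, integral_cpow (Or.inl (hre n)), half_cpow,
      ofReal_zero, zero_cpow h1, sub_zero]
    congr 3 <;> ring
  · intro n
    refine (Measurable.aestronglyMeasurable ?_)
    exact (measurable_ofReal.pow_const _).const_mul _
  · intro n
    refine Eventually.of_forall fun t ht => ?_
    rw [hIoc] at ht
    obtain ⟨ht0, ht1⟩ := ht
    rw [norm_mul, norm_cpow_eq_rpow_re_of_pos ht0]
    have e1 : (2 * ((n + M : ℕ) : ℂ) - s).re = (2 * M - s.re) + ((2 * n : ℕ) : ℝ) := by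
      simp
      ring
    rw [e1, Real.rpow_add ht0, Real.rpow_natCast]
    have h1 := hC s (n + M) le_rfl
    have h2 : t ^ (2 * n) ≤ (1 / 2) ^ (2 * n) := by gcongr
    calc ‖alpha (n + M) s‖ * (t ^ (2 * M - s.re) * t ^ (2 * n))
        ≤ C / (11 / 20) ^ (2 * (n + M)) * (t ^ (2 * M - s.re) * (1 / 2) ^ (2 * n)) := by gcongr
      _ = D * t ^ (2 * M - s.re) * ((1 / 2) ^ (2 * n) / (11 / 20) ^ (2 * n)) := by
          simp only [D]
          rw [mul_add, pow_add]
          field_simp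
      _ = _ := by
          rw [← div_pow, pow_mul]
          norm_num
  · refine Eventually.of_forall fun t _ => ?_
    exact (summable_geometric_of_lt_one (by norm_num) (by norm_num)).mul_left _
  · simp only [tsum_mul_left]
    refine IntervalIntegrable.mul_const (IntervalIntegrable.const_mul ?_ D) _
    exact intervalIntegral.intervalIntegrable_rpow' (by linarith)
  · refine Eventually.of_forall fun t ht => ?_
    rw [hIoc] at ht
    obtain ⟨ht0, ht1⟩ := ht
    have ht' : (t : ℂ) ≠ 0 := by exact_mod_cast ht0.ne'
    have hn : ‖(t : ℂ)‖ < 3 / 5 := by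
      rw [norm_real, Real.norm_of_nonneg ht0.le]
      linarith
    have h := ((hasSum_nat_add_iff' M).mpr (hasSum_alpha s hn)).mul_left ((t : ℂ) ^ (-s))
    refine h.congr_fun fun n => ?_
    rw [sub_eq_neg_add, cpow_add _ _ ht',
      show (2 * ((n + M : ℕ) : ℂ)) = ((2 * (n + M) : ℕ) : ℂ) by push_cast; ring, cpow_natCast]
    ring

lemma norm_circleTerm_le {R C : ℝ} (hC : ∀ (s : ℂ) (n : ℕ), ‖s‖ ≤ R →
    ‖alpha n s‖ ≤ C / (11 / 20) ^ (2 * n)) {s : ℂ} (hs : ‖s‖ ≤ R) {n : ℕ}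
    (hn : R ≤ n) : ‖circleTerm s n‖ ≤ C * 2 ^ R * (100 / 121) ^ n := by
  have hsre : s.re ≤ R := (re_le_norm s).trans hs
  have h1 : (1 : ℝ) ≤ ‖2 * (n : ℂ) + 1 - s‖ := by
    refine le_trans ?_ (re_le_norm _)
    simp
    have : (0 : ℝ) ≤ n := by positivity
    linarith
  have hp : ‖(2 : ℂ) ^ (s - 2 * n - 1)‖ ≤ 2 ^ R * (1 / 2) ^ (2 * n) := by
    rw [show (2 : ℂ) = ((2 : ℝ) : ℂ) by norm_num, norm_cpow_eq_rpow_re_of_pos two_pos]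
    have : (2 : ℝ) ^ R * (1 / 2) ^ (2 * n) = 2 ^ (R - ((2 * n : ℕ) : ℝ)) := by
      rw [Real.rpow_sub two_pos, Real.rpow_natCast]
      simp [div_eq_mul_inv]
    rw [this]
    apply Real.rpow_le_rpow_of_exponent_le one_le_two
    simp
    linarith
  have hC' := hC s n hs
  have hdiv : ‖(2 : ℂ) ^ (s - 2 * n - 1)‖ / ‖2 * (n : ℂ) + 1 - s‖ ≤ 2 ^ R * (1 / 2) ^ (2 * n) :=
    (div_le_self (norm_nonneg _) h1).trans hp
  rw [circleTerm, norm_mul, norm_div]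
  calc ‖alpha n s‖ * (‖(2 : ℂ) ^ (s - 2 * n - 1)‖ / ‖2 * (n : ℂ) + 1 - s‖)
      ≤ C / (11 / 20) ^ (2 * n) * (2 ^ R * (1 / 2) ^ (2 * n)) :=
        mul_le_mul hC' hdiv (by positivity) ((norm_nonneg _).trans hC')
    _ = C * 2 ^ R * ((1 / 2) ^ (2 * n) / (11 / 20) ^ (2 * n)) := by field_simp
    _ = _ := by
        rw [← div_pow, pow_mul]
        norm_num

lemma summable_circleTerm (s : ℂ) : Summable (circleTerm s) := by
  obtain ⟨C, hC0, hC⟩ := exists_norm_alpha_le ‖s‖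
  obtain ⟨N, hN⟩ := exists_nat_ge ‖s‖
  have hg : Summable fun n : ℕ => C * 2 ^ ‖s‖ * (100 / 121 : ℝ) ^ n :=
    (summable_geometric_of_lt_one (by norm_num) (by norm_num)).mul_left _
  refine Summable.of_norm_bounded_eventually_nat hg ?_
  filter_upwards [eventually_ge_atTop N] with n hn
  exact norm_circleTerm_le hC le_rfl (hN.trans (by exact_mod_cast hn))

/-- The complement of the odd positive integers. -/
def oddCompl : Set ℂ := (Set.range fun m : ℕ => 2 * (m : ℂ) + 1)ᶜ

lemma mem_oddCompl {s : ℂ} : s ∈ oddCompl ↔ ∀ m : ℕ, s ≠ 2 * (m : ℂ) + 1 := by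
  simp [oddCompl, eq_comm]

lemma isOpen_oddCompl : IsOpen oddCompl := by
  rw [oddCompl, isOpen_compl_iff]
  refine (Metric.isClosedEmbedding_of_pairwise_le_dist one_pos fun a b hab => ?_).isClosed_range
  beta_reduce
  rw [dist_eq, add_sub_add_right_eq_sub, ← mul_sub, norm_mul]
  have h1 : (1 : ℝ) ≤ ‖((a : ℂ) - b)‖ := by
    have h2 : (1 : ℤ) ≤ |(a : ℤ) - (b : ℤ)| :=
      Int.one_le_abs (sub_ne_zero.mpr (fun h => hab (Int.ofNat_inj.mp h)))
    have h3 : ((a : ℂ) - b) = (((a : ℤ) - (b : ℤ) : ℤ) : ℂ) := by push_cast; rfl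
    rw [h3, norm_intCast, ← Int.cast_abs, ← Int.cast_one (R := ℝ)]
    exact Int.cast_le.mpr h2
  rw [Complex.norm_ofNat]
  linarith

lemma isPreconnected_oddCompl : IsPreconnected oddCompl :=
  ((Set.countable_range _).isConnected_compl_of_one_lt_rank (by simp)).isPreconnected

lemma differentiableOn_circleTerm (n : ℕ) :
    DifferentiableOn ℂ (fun s => circleTerm s n) oddCompl := by
  intro s hs
  have h : (2 * (n : ℂ) + 1 - s) ≠ 0 := sub_ne_zero.mpr (mem_oddCompl.mp hs n).symm
  have h2 : DifferentiableAt ℂ (fun s : ℂ => (2 : ℂ) ^ (s - 2 * n - 1)) s :=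
    ((differentiableAt_id.sub_const _).sub_const _).const_cpow (Or.inl two_ne_zero)
  exact ((differentiable_alpha n s).mul (h2.div (differentiableAt_id.const_sub _)
    h)).differentiableWithinAt

lemma differentiableOn_tsum_circleTerm :
    DifferentiableOn ℂ (fun s => ∑' n, circleTerm s n) oddCompl := by
  intro s hs
  set R : ℝ := ‖s‖ + 1
  obtain ⟨C, hC0, hC⟩ := exists_norm_alpha_le R
  obtain ⟨N, hN⟩ := exists_nat_ge R
  have hg : Summable fun n : ℕ => C * 2 ^ R * (100 / 121 : ℝ) ^ (n + N) :=
    (summable_nat_add_iff N).mpr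
      ((summable_geometric_of_lt_one (by norm_num) (by norm_num)).mul_left _)
  -- The uniform bound needs n ≥ R, which keeps 2n + 1 - s away from 0. The finitely many earlier
  -- terms, with possible poles in the ball, are added separately.
  have hU : IsOpen (Metric.ball 0 R ∩ oddCompl) := Metric.isOpen_ball.inter isOpen_oddCompl
  have hd := differentiableOn_tsum_of_summable_norm hg (U := Metric.ball 0 R ∩ oddCompl)
    (F := fun n s => circleTerm s (n + N))
    (fun n => (differentiableOn_circleTerm (n + N)).mono Set.inter_subset_right) hU
    (fun n z hz => norm_circleTerm_le hC (mem_ball_zero_iff.mp hz.1).le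
      (hN.trans (by push_cast; linarith [show (0 : ℝ) ≤ n by positivity])))
  have hmem : s ∈ Metric.ball 0 R ∩ oddCompl := ⟨by simp [R], hs⟩
  have h1 : DifferentiableAt ℂ (fun s => ∑ n ∈ Finset.range N, circleTerm s n) s :=
    DifferentiableAt.fun_sum fun n _ =>
      (differentiableOn_circleTerm n).differentiableAt (isOpen_oddCompl.mem_nhds hs)
  have h2 := h1.add (hd.differentiableAt (hU.mem_nhds hmem))
  refine (h2.congr_of_eventuallyEq (Eventually.of_forall fun z => ?_)).differentiableWithinAt
  exact ((summable_circleTerm z).sum_add_tsum_nat_add N).symm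

lemma differentiableOn_circleV : DifferentiableOn ℂ circleV oddCompl := by
  intro s hs
  rw [mem_oddCompl] at hs
  have h1 : DifferentiableAt ℂ (fun s : ℂ => (2 : ℂ) ^ (-s)) s :=
    cpow_neg_differentiable two_ne_zero s
  have h2 : DifferentiableAt ℂ (fun s : ℂ => Gamma ((1 - s) / 2)) s := by
    have hg : DifferentiableAt ℂ Gamma ((1 - s) / 2) := differentiableAt_Gamma _ fun m hm => by
      apply hs m
      linear_combination -2 * hm
    exact hg.comp s ((differentiableAt_id.const_sub 1).div_const 2)
  have h3 : DifferentiableAt ℂ (fun s : ℂ => (Gamma (1 - s / 2))⁻¹) s :=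
    (differentiable_one_div_Gamma _).comp s ((differentiableAt_id.div_const 2).const_sub 1)
  have h4 := (h1.mul h2).mul (h3.const_mul ((Real.sqrt Real.pi : ℂ))⁻¹)
  refine (h4.congr_of_eventuallyEq (Eventually.of_forall fun z => ?_)).differentiableWithinAt
  simp only [circleV, Pi.mul_apply]
  rw [div_eq_mul_inv, mul_inv]

/-- The function `|2 sin π x| ^ (-s)` of period `1`. -/
noncomputable def rieszKernel (s : ℂ) (x : ℝ) : ℂ := ((|2 * Real.sin (Real.pi * x)| : ℝ) : ℂ) ^ (-s)

lemma rieszKernel_eq (s : ℂ) {x : ℝ} (hx0 : x ≠ 0) (hx1 : |x| < 1) :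
    rieszKernel s x = ((2 * Real.pi : ℝ) : ℂ) ^ (-s) * (((|x| : ℝ) : ℂ) ^ (-s) * csinc x ^ (-s)) := by
  have hxpos : 0 < |x| := abs_pos.mpr hx0
  have hpi := Real.pi_pos
  have hsin : 0 < Real.sin (Real.pi * |x|) :=
    Real.sin_pos_of_pos_of_lt_pi (by positivity) (by nlinarith)
  have hc : csinc x = ((Real.sin (Real.pi * |x|) / (Real.pi * |x|) : ℝ) : ℂ) := by
    have h1 : csinc x = csinc ((|x| : ℝ) : ℂ) := by
      rcases abs_cases x with ⟨h, -⟩ | ⟨h, -⟩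
      · rw [h]
      · rw [h, ofReal_neg, csinc_neg]
    rw [h1, csinc, if_neg (by exact_mod_cast hxpos.ne')]
    push_cast
    rfl
  have habs : |2 * Real.sin (Real.pi * x)| = 2 * Real.sin (Real.pi * |x|) := by
    rw [abs_mul, abs_two]
    congr 1
    rcases abs_cases x with ⟨h, -⟩ | ⟨h, -⟩
    · rw [h] at hsin ⊢
      exact abs_of_pos hsin
    · rw [h, mul_neg, Real.sin_neg] at hsin ⊢
      exact abs_of_neg (by linarith)
  rw [rieszKernel, habs, hc, ← mul_cpow_ofReal_nonneg (abs_nonneg x) (by positivity), ← ofReal_mul,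
    ← mul_cpow_ofReal_nonneg (by positivity) (by positivity), ← ofReal_mul]
  congr 2
  field_simp

lemma image_sin_sq : (fun x : ℝ => Real.sin (Real.pi * x) ^ 2) '' Set.Ioo 0 (1 / 2) = Set.Ioo 0 1 := by
  have hpi := Real.pi_pos
  ext y
  constructor
  · rintro ⟨x, ⟨h0, h1⟩, rfl⟩
    have hs : 0 < Real.sin (Real.pi * x) :=
      Real.sin_pos_of_pos_of_lt_pi (by positivity) (by nlinarith)
    have hc : 0 < Real.cos (Real.pi * x) :=
      Real.cos_pos_of_mem_Ioo ⟨by nlinarith, by nlinarith⟩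
    have := Real.sin_sq_add_cos_sq (Real.pi * x)
    exact ⟨by positivity, by simp only; nlinarith⟩
  · rintro ⟨h0, h1⟩
    have hs0 : 0 < Real.sqrt y := Real.sqrt_pos.mpr h0
    have hs1 : Real.sqrt y < 1 := by
      rw [Real.sqrt_lt' one_pos]
      simpa using h1
    refine ⟨Real.arcsin (Real.sqrt y) / Real.pi, ⟨?_, ?_⟩, ?_⟩
    · exact div_pos (Real.arcsin_pos.mpr hs0) hpi
    · rw [div_lt_iff₀ hpi]
      have := Real.arcsin_lt_pi_div_two.mpr hs1
      linarith
    · simp only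
      rw [mul_div_cancel₀ _ hpi.ne', Real.sin_arcsin (by linarith) hs1.le, Real.sq_sqrt h0.le]

/-- Substitution y = sin²(πx), under which (1-y)^(-1/2) cancels the cosine of the Jacobian. -/
lemma betaIntegral_eq_integral_sin (u : ℂ) :
    betaIntegral u (1 / 2)
      = 2 * Real.pi * ∫ x in (0 : ℝ)..(1 / 2), ((Real.sin (Real.pi * x) : ℝ) : ℂ) ^ (2 * u - 1) := by
  have hpi := Real.pi_pos
  have hinj : Set.InjOn (fun x : ℝ => Real.sin (Real.pi * x) ^ 2) (Set.Ioo 0 (1 / 2)) := by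
    rintro x ⟨hx0, hx1⟩ y ⟨hy0, hy1⟩ hxy
    have hsx : 0 < Real.sin (Real.pi * x) :=
      Real.sin_pos_of_pos_of_lt_pi (by positivity) (by nlinarith)
    have hsy : 0 < Real.sin (Real.pi * y) :=
      Real.sin_pos_of_pos_of_lt_pi (by positivity) (by nlinarith)
    have h1 : Real.sin (Real.pi * x) = Real.sin (Real.pi * y) :=
      (pow_left_inj₀ hsx.le hsy.le two_ne_zero).mp hxy
    have h2 := Real.injOn_sin ⟨by nlinarith, by nlinarith⟩ ⟨by nlinarith, by nlinarith⟩ h1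
    exact mul_left_cancel₀ hpi.ne' h2
  have hder : ∀ x ∈ Set.Ioo (0 : ℝ) (1 / 2), HasDerivWithinAt
      (fun x : ℝ => Real.sin (Real.pi * x) ^ 2)
      (2 * Real.pi * Real.sin (Real.pi * x) * Real.cos (Real.pi * x)) (Set.Ioo 0 (1 / 2)) x := by
    intro x _
    have h1 : HasDerivAt (fun x : ℝ => Real.pi * x) (Real.pi * 1) x :=
      (hasDerivAt_id x).const_mul Real.pi
    refine ((h1.sin.pow 2).congr_deriv ?_).hasDerivWithinAt
    push_cast
    ring
  have key := integral_image_eq_integral_abs_deriv_smul measurableSet_Ioo hder hinj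
    (fun y : ℝ => (y : ℂ) ^ (u - 1) * (1 - (y : ℂ)) ^ ((1 / 2 : ℂ) - 1))
  rw [image_sin_sq] at key
  rw [betaIntegral, intervalIntegral.integral_of_le zero_le_one, integral_Ioc_eq_integral_Ioo, key,
    ← intervalIntegral.integral_const_mul, intervalIntegral.integral_of_le (by norm_num),
    integral_Ioc_eq_integral_Ioo]
  refine setIntegral_congr_fun measurableSet_Ioo fun x hx => ?_
  obtain ⟨h0, h1⟩ := hx
  have hs : 0 < Real.sin (Real.pi * x) :=
    Real.sin_pos_of_pos_of_lt_pi (by positivity) (by nlinarith)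
  have hc : 0 < Real.cos (Real.pi * x) :=
    Real.cos_pos_of_mem_Ioo ⟨by nlinarith, by nlinarith⟩
  set a := Real.sin (Real.pi * x)
  set b := Real.cos (Real.pi * x)
  have hab : a ^ 2 + b ^ 2 = 1 := Real.sin_sq_add_cos_sq _
  have hac : (a : ℂ) ≠ 0 := by exact_mod_cast hs.ne'
  have hbc : (b : ℂ) ≠ 0 := by exact_mod_cast hc.ne'
  have e1 : (1 - ((a ^ 2 : ℝ) : ℂ)) = ((b * b : ℝ) : ℂ) := by
    rw [← ofReal_one, ← ofReal_sub]
    congr 1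
    linarith
  have e2 : ((b * b : ℝ) : ℂ) ^ ((1 / 2 : ℂ) - 1) = (b : ℂ)⁻¹ := by
    rw [ofReal_mul, mul_cpow_ofReal_nonneg hc.le hc.le, ← cpow_add _ _ hbc, ← cpow_neg_one]
    norm_num
  have e3 : ((a ^ 2 : ℝ) : ℂ) ^ (u - 1) = (a : ℂ) ^ (2 * u - 1) * (a : ℂ)⁻¹ := by
    rw [pow_two, ofReal_mul, mul_cpow_ofReal_nonneg hs.le hs.le, ← cpow_add _ _ hac, ← cpow_neg_one,
      ← cpow_add _ _ hac]
    ring_nf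
  simp only [e1, e2, e3]
  rw [abs_of_pos (by positivity), real_smul]
  push_cast
  field_simp

lemma circleV_eq_integral {s : ℂ} (hs : s.re < 1) :
    circleV s = 2 * ∫ x in (0 : ℝ)..(1 / 2), rieszKernel s x := by
  have hpi := Real.pi_pos
  have hpiC : (Real.pi : ℂ) ≠ 0 := by exact_mod_cast hpi.ne'
  have hu : 0 < ((1 - s) / 2).re := by
    have : ((1 - s) / 2).re = (1 - s.re) / 2 := by
      rw [show (1 - s) / 2 = ((1 / 2 : ℝ) : ℂ) * (1 - s) by push_cast; ring, re_ofReal_mul]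
      simp
      ring
    rw [this]
    linarith
  have hG := Gamma_mul_Gamma_eq_betaIntegral hu (t := 1 / 2) (by norm_num)
  rw [betaIntegral_eq_integral_sin, show (1 - s) / 2 + 1 / 2 = 1 - s / 2 by ring,
    show 2 * ((1 - s) / 2) - 1 = -s by ring] at hG
  have hsq : Gamma (1 / 2) = (Real.sqrt Real.pi : ℂ) := by
    rw [Complex.Gamma_one_half_eq, show (1 / 2 : ℂ) = ((1 / 2 : ℝ) : ℂ) by norm_num,
      ← ofReal_cpow hpi.le, Real.sqrt_eq_rpow]
  have hk : (∫ x in (0 : ℝ)..(1 / 2), rieszKernel s x) = (2 : ℂ) ^ (-s) *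
      ∫ x in (0 : ℝ)..(1 / 2), ((Real.sin (Real.pi * x) : ℝ) : ℂ) ^ (-s) := by
    rw [← intervalIntegral.integral_const_mul]
    refine intervalIntegral.integral_congr fun x hx => ?_
    rw [Set.uIcc_of_le (by norm_num)] at hx
    have hsin : 0 ≤ Real.sin (Real.pi * x) :=
      Real.sin_nonneg_of_nonneg_of_le_pi (mul_nonneg hpi.le hx.1) (by nlinarith [hx.2])
    simp only [rieszKernel]
    rw [abs_of_nonneg (by positivity), ofReal_mul, mul_cpow_ofReal_nonneg (by norm_num) hsin]
    norm_num
  have hne : Gamma (1 - s / 2) ≠ 0 := by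
    refine Gamma_ne_zero_of_re_pos ?_
    have : (1 - s / 2).re = 1 - s.re / 2 := by
      rw [show 1 - s / 2 = 1 - ((1 / 2 : ℝ) : ℂ) * s by push_cast; ring, sub_re, re_ofReal_mul]
      simp
      ring
    rw [this]
    linarith
  have hsqne : (Real.sqrt Real.pi : ℂ) ≠ 0 := by
    exact_mod_cast (Real.sqrt_pos.mpr hpi).ne'
  have hsqsq : (Real.sqrt Real.pi : ℂ) * (Real.sqrt Real.pi : ℂ) = Real.pi := by
    rw [← ofReal_mul, Real.mul_self_sqrt hpi.le]
  rw [hsq] at hG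
  rw [hk, circleV, div_eq_iff (mul_ne_zero hsqne hne)]
  set J := ∫ x in (0 : ℝ)..(1 / 2), ((Real.sin (Real.pi * x) : ℝ) : ℂ) ^ (-s)
  apply mul_right_cancel₀ hsqne
  linear_combination (2 : ℂ) ^ (-s) * hG - 2 * (2 : ℂ) ^ (-s) * J * Gamma (1 - s / 2) * hsqsq

/-- The constant `circleV s` as the sum of a series, for all `s` but the odd positive integers. -/
theorem circleV_eq_tsum {s : ℂ} (hs : ∀ m : ℕ, s ≠ 2 * (m : ℂ) + 1) :
    circleV s = 2 * ((2 * Real.pi : ℝ) : ℂ) ^ (-s) * ∑' n, circleTerm s n := by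
  have hpi := Real.pi_pos
  have hbase : ∀ s : ℂ, s.re < 1 →
      circleV s = 2 * ((2 * Real.pi : ℝ) : ℂ) ^ (-s) * ∑' n, circleTerm s n := by
    intro s hs
    have h := hasSum_integral_csinc_cpow (s := s) (M := 0) (by simpa using hs)
    simp only [add_zero, Finset.range_zero, Finset.sum_empty, sub_zero] at h
    rw [circleV_eq_integral hs, h.tsum_eq, mul_assoc]
    congr 1
    rw [← intervalIntegral.integral_const_mul]
    refine intervalIntegral.integral_congr_ae (Eventually.of_forall fun x hx => ?_)
    rw [Set.uIoc_of_le (by norm_num)] at hx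
    rw [rieszKernel_eq s hx.1.ne' (by rw [abs_of_pos hx.1]; linarith [hx.2]), abs_of_pos hx.1]
  have h2pi : ((2 * Real.pi : ℝ) : ℂ) ≠ 0 := by exact_mod_cast (by positivity : 2 * Real.pi ≠ 0)
  have hg : DifferentiableOn ℂ
      (fun s => 2 * ((2 * Real.pi : ℝ) : ℂ) ^ (-s) * ∑' n, circleTerm s n) oddCompl :=
    (((cpow_neg_differentiable h2pi).const_mul 2).differentiableOn).mul
      differentiableOn_tsum_circleTerm
  -- Identity theorem: the plane minus a countable set is connected, and both sides agree near s =
  -- 0.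
  refine (differentiableOn_circleV.analyticOnNhd isOpen_oddCompl).eqOn_of_preconnected_of_eventuallyEq
    (hg.analyticOnNhd isOpen_oddCompl) isPreconnected_oddCompl (z₀ := 0) ?_ ?_ (mem_oddCompl.mpr hs)
  · rw [mem_oddCompl]
    intro m h
    have := congrArg re h
    simp at this
    linarith [show (0 : ℝ) ≤ m by positivity]
  · filter_upwards [(isOpen_lt continuous_re continuous_const).mem_nhds
      (show (0 : ℂ).re < 1 by simp)] with z hz using hbase z hz

end CircleConstant

/-! ### The regularized kernel: smoothness, integral and lattice sum -/

section Remainder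

open Complex HurwitzZeta MeasureTheory Function

lemma rieszKernel_periodic (s : ℂ) : Periodic (rieszKernel s) 1 := by
  intro x
  simp only [rieszKernel, mul_add, mul_one, Real.sin_add_pi, mul_neg, abs_neg]

lemma rieszKernel_neg (s : ℂ) (x : ℝ) : rieszKernel s (-x) = rieszKernel s x := by
  simp only [rieszKernel, mul_neg, Real.sin_neg, abs_neg]

lemma rieszKernel_zero {s : ℂ} (hs : s ≠ 0) : rieszKernel s 0 = 0 := by
  simp [rieszKernel, hs]

/-- The Riesz kernel with its first `P` singular terms removed. -/
noncomputable def kernelRemainder (s : ℂ) (P : ℕ) (x : ℝ) : ℂ :=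
  rieszKernel s x - ((2 * Real.pi : ℝ) : ℂ) ^ (-s) * ∑ n ∈ Finset.range P,
    alpha n s * (2 * hurwitzZetaEven (x : UnitAddCircle) (s - 2 * n))

lemma kernelRemainder_periodic (s : ℂ) (P : ℕ) : Periodic (kernelRemainder s P) 1 := by
  intro x
  have : ((x + 1 : ℝ) : UnitAddCircle) = (x : UnitAddCircle) := AddCircle.coe_add_period 1 x
  rw [kernelRemainder, kernelRemainder, this, rieszKernel_periodic]

lemma kernelRemainder_neg (s : ℂ) (P : ℕ) (x : ℝ) :
    kernelRemainder s P (-x) = kernelRemainder s P x := by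
  have : ((-x : ℝ) : UnitAddCircle) = -(x : UnitAddCircle) := AddCircle.coe_neg 1
  simp only [kernelRemainder, this, rieszKernel_neg, hurwitzZetaEven_neg]

/-- The tail `∑_{n ≥ P} α_n(s) z ^ (2 (n - P))`. -/
noncomputable def alphaTail (s : ℂ) (P : ℕ) (z : ℂ) : ℂ := ∑' n, alpha (n + P) s * z ^ (2 * n)

lemma differentiableOn_alphaTail (s : ℂ) (P : ℕ) :
    DifferentiableOn ℂ (alphaTail s P) (Metric.ball 0 (21 / 40)) := by
  obtain ⟨C, hC0, hC⟩ := exists_norm_alpha_le ‖s‖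
  -- The radius 21/40 lies between 1/2 and 11/20, and (21/40)/(11/20) = 21/22 has square 441/484.
  have hg : Summable fun n : ℕ => C / (11 / 20) ^ (2 * P) * (441 / 484 : ℝ) ^ n :=
    (summable_geometric_of_lt_one (by norm_num) (by norm_num)).mul_left _
  refine differentiableOn_tsum_of_summable_norm hg (fun n => by fun_prop) Metric.isOpen_ball
    fun n z hz => ?_
  have hz' : ‖z‖ ≤ 21 / 40 := (mem_ball_zero_iff.mp hz).le
  rw [norm_mul, norm_pow]
  calc ‖alpha (n + P) s‖ * ‖z‖ ^ (2 * n)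
      ≤ C / (11 / 20) ^ (2 * (n + P)) * (21 / 40) ^ (2 * n) := by
        gcongr
        exact hC s (n + P) le_rfl
    _ = C / (11 / 20) ^ (2 * P) * ((21 / 40) ^ (2 * n) / (11 / 20) ^ (2 * n)) := by
        rw [mul_add, pow_add]
        field_simp
    _ = _ := by
        rw [← div_pow, pow_mul (21 / 40 / (11 / 20) : ℝ)]
        norm_num

lemma csinc_cpow_eq (s : ℂ) (P : ℕ) {z : ℂ} (hz : ‖z‖ < 3 / 5) :
    csinc z ^ (-s) = ∑ n ∈ Finset.range P, alpha n s * z ^ (2 * n) + z ^ (2 * P) * alphaTail s P z := by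
  have h := hasSum_alpha s hz
  rw [← h.tsum_eq, ← h.summable.sum_add_tsum_nat_add P, alphaTail, ← tsum_mul_left]
  congr 1
  refine tsum_congr fun n => ?_
  rw [mul_add, pow_add]
  ring

lemma abs_cpow_mul_pow (s : ℂ) (n : ℕ) {x : ℝ} (hx : x ≠ 0) :
    ((|x| : ℝ) : ℂ) ^ (-s) * (x : ℂ) ^ (2 * n) = ((|x| : ℝ) : ℂ) ^ (-(s - 2 * n)) := by
  have hx' : ((|x| : ℝ) : ℂ) ≠ 0 := by exact_mod_cast (abs_pos.mpr hx).ne'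
  have h : (x : ℂ) ^ (2 * n) = ((|x| : ℝ) : ℂ) ^ (2 * n) := by
    rw [← ofReal_pow, ← ofReal_pow, pow_mul, pow_mul, sq_abs]
  rw [h, ← cpow_natCast, ← cpow_add _ _ hx']
  congr 1
  push_cast
  ring

lemma neg_sub_two_mul_ne_zero {s : ℂ} {P : ℕ} (hP : s.re < 2 * P) : -(s - 2 * (P : ℂ)) ≠ 0 := by
  intro h
  have := congrArg re h
  simp at this
  linarith

lemma abs_cpow_mul_csinc_sub {s : ℂ} (hs0 : s ≠ 0) {P : ℕ} (hP : s.re < 2 * P) {x : ℝ}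
    (hx : |x| < 3 / 5) :
    ((|x| : ℝ) : ℂ) ^ (-s) * (csinc x ^ (-s) - ∑ n ∈ Finset.range P, alpha n s * (x : ℂ) ^ (2 * n))
      = ((|x| : ℝ) : ℂ) ^ (-(s - 2 * P)) * alphaTail s P x := by
  rcases eq_or_ne x 0 with rfl | hx0
  · rw [abs_zero, ofReal_zero, zero_cpow (neg_ne_zero.mpr hs0),
      zero_cpow (neg_sub_two_mul_ne_zero hP), zero_mul, zero_mul]
  · rw [csinc_cpow_eq s P (by simpa using hx), add_sub_cancel_left, ← mul_assoc,
      abs_cpow_mul_pow s P hx0]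

lemma two_mul_hurwitzZetaEven_abs {w : ℂ} (hw : w ≠ 1) {x : ℝ} (hx0 : x ≠ 0) (hx1 : |x| < 1) :
    2 * hurwitzZetaEven (x : UnitAddCircle) w = ((|x| : ℝ) : ℂ) ^ (-w)
      + (w - 1)⁻¹ * (hurwitzSeries w x + hurwitzSeries w (-x)) := by
  rcases lt_or_gt_of_ne hx0 with h | h
  · rw [abs_of_neg h] at hx1 ⊢
    have := two_mul_hurwitzZetaEven hw (neg_pos.mpr h) hx1
    have e : ((-x : ℝ) : UnitAddCircle) = -(x : UnitAddCircle) := AddCircle.coe_neg 1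
    rw [e, hurwitzZetaEven_neg] at this
    rw [this]
    push_cast
    rw [neg_neg, add_comm (hurwitzSeries w (-x))]
  · rw [abs_of_pos h] at hx1 ⊢
    exact two_mul_hurwitzZetaEven hw h hx1

lemma ne_one_of_odd {s : ℂ} (hs1 : ∀ m : ℕ, s ≠ 2 * (m : ℂ) + 1) (n : ℕ) : s - 2 * n ≠ 1 :=
  fun h => hs1 n (by linear_combination h)

/-- Near `0` the remainder is a smooth function. -/
lemma kernelRemainder_eq {s : ℂ} (hs0 : s ≠ 0) (hs1 : ∀ m : ℕ, s ≠ 2 * (m : ℂ) + 1) {P : ℕ}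
    (hP : s.re < 2 * P) {x : ℝ} (hx : |x| < 3 / 5) :
    kernelRemainder s P x = ((2 * Real.pi : ℝ) : ℂ) ^ (-s) *
      (((|x| : ℝ) : ℂ) ^ (-(s - 2 * P)) * alphaTail s P x - ∑ n ∈ Finset.range P,
        alpha n s * ((s - 2 * n - 1)⁻¹ *
          (hurwitzSeries (s - 2 * n) x + hurwitzSeries (s - 2 * n) (-x)))) := by
  rcases eq_or_ne x 0 with rfl | hx0
  -- The conventions at 0 match: the kernel is 0, and the zeta function takes the value ζ(w), its
  -- singular term being dropped. Hence the formula holds at 0 too.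
  · rw [kernelRemainder, rieszKernel_zero hs0, abs_zero, ofReal_zero,
      zero_cpow (neg_sub_two_mul_ne_zero hP), neg_zero,
      show ((0 : ℝ) : UnitAddCircle) = 0 from rfl, hurwitzZetaEven_zero]
    rw [zero_sub, zero_mul, zero_sub, mul_neg]
    congr 2
    refine Finset.sum_congr rfl fun n _ => ?_
    have hne := ne_one_of_odd hs1 n
    rw [hurwitzSeries_zero hne]
    have := sub_ne_zero.mpr hne
    field_simp
    ring
  · rw [← abs_cpow_mul_csinc_sub hs0 hP hx, kernelRemainder,
      rieszKernel_eq s hx0 (by linarith), ← mul_sub, mul_sub (((|x| : ℝ) : ℂ) ^ (-s)), sub_sub]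
    congr 2
    rw [Finset.mul_sum, ← Finset.sum_add_distrib]
    refine Finset.sum_congr rfl fun n _ => ?_
    rw [two_mul_hurwitzZetaEven_abs (ne_one_of_odd hs1 n) hx0 (by linarith),
      ← abs_cpow_mul_pow s n hx0]
    ring

lemma contDiffAt_ofReal_of_differentiableOn {f : ℂ → ℂ} {U : Set ℂ} (hU : IsOpen U)
    (hf : DifferentiableOn ℂ f U) {x : ℝ} (hx : (x : ℂ) ∈ U) {n : WithTop ℕ∞} :
    ContDiffAt ℝ n (fun y : ℝ => f y) x := by
  have h1 : ContDiffAt ℝ n f (x : ℂ) := ((hf.analyticOnNhd hU _ hx).contDiffAt).restrict_scalars ℝ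
  exact h1.comp x ofRealCLM.contDiff.contDiffAt

/-- On |x| < 3/5 the singular powers cancel, leaving |x|^(2P-s) times an analytic function near
[-1/2, 1/2], plus analytic terms. Subtracting the nearest integer reduces any point to this
interval. -/
lemma contDiff_kernelRemainder {s : ℂ} (hs0 : s ≠ 0) (hs1 : ∀ m : ℕ, s ≠ 2 * (m : ℂ) + 1)
    {P K : ℕ} (hP : s.re + K < 2 * P) : ContDiff ℝ K (kernelRemainder s P) := by
  have hP' : s.re < 2 * P := by linarith [show (0 : ℝ) ≤ K by positivity]
  have hloc : ∀ x : ℝ, |x| ≤ 1 / 2 → ContDiffAt ℝ K (kernelRemainder s P) x := by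
    intro x hx
    have hx1 : (x : ℂ) ∈ Metric.ball (0 : ℂ) (21 / 40) := by
      rw [mem_ball_zero_iff, norm_real, Real.norm_eq_abs]
      linarith
    have hx2 : (x : ℂ) ∈ Metric.ball (0 : ℂ) 1 := by
      rw [mem_ball_zero_iff, norm_real, Real.norm_eq_abs]
      linarith
    have hx3 : ((-x : ℝ) : ℂ) ∈ Metric.ball (0 : ℂ) 1 := by
      rw [mem_ball_zero_iff, norm_real, Real.norm_eq_abs, abs_neg]
      linarith
    have hev : kernelRemainder s P =ᶠ[nhds x] fun x : ℝ => ((2 * Real.pi : ℝ) : ℂ) ^ (-s) *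
      (((|x| : ℝ) : ℂ) ^ (-(s - 2 * P)) * alphaTail s P x - ∑ n ∈ Finset.range P,
        alpha n s * ((s - 2 * n - 1)⁻¹ *
          (hurwitzSeries (s - 2 * n) x + hurwitzSeries (s - 2 * n) (-x)))) := by
      filter_upwards [(isOpen_lt continuous_abs continuous_const).mem_nhds
        (show |x| < 3 / 5 by linarith)] with y hy using kernelRemainder_eq hs0 hs1 hP' hy
    refine ContDiffAt.congr_of_eventuallyEq ?_ hev
    have hA : ContDiffAt ℝ K (fun x : ℝ => ((|x| : ℝ) : ℂ) ^ (-(s - 2 * (P : ℂ)))) x :=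
      (contDiff_abs_cpow (by simp; linarith)).contDiffAt
    have hB : ContDiffAt ℝ K (fun x : ℝ => alphaTail s P x) x :=
      contDiffAt_ofReal_of_differentiableOn Metric.isOpen_ball (differentiableOn_alphaTail s P) hx1
    refine contDiffAt_const.mul ((hA.mul hB).sub (ContDiffAt.sum fun n _ => ?_))
    refine contDiffAt_const.mul (contDiffAt_const.mul ?_)
    have hC := contDiffAt_ofReal_of_differentiableOn (n := K) Metric.isOpen_ball
      (differentiableOn_hurwitzSeries (s - 2 * n)) hx2
    have hD := contDiffAt_ofReal_of_differentiableOn (n := K) Metric.isOpen_ball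
      (differentiableOn_hurwitzSeries (s - 2 * n)) hx3
    have hD' := hD.comp x (f := fun y : ℝ => -y) contDiff_neg.contDiffAt
    refine hC.add (hD'.congr_of_eventuallyEq (Eventually.of_forall fun y => ?_))
    simp
  rw [contDiff_iff_contDiffAt]
  intro x
  have hr := abs_sub_round x
  have h1 := (hloc (x - round x) hr).comp x (f := fun y : ℝ => y - round x)
    (contDiff_id.sub contDiff_const).contDiffAt
  refine h1.congr_of_eventuallyEq (Eventually.of_forall fun y => ?_)
  have := (kernelRemainder_periodic s P).sub_int_mul_eq (x := y) (round x)
  rw [mul_one] at this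
  exact this.symm

/-- The terms n ≥ P come from integrating the tail, the terms n < P from `integral_hurwitzSeries`.
They fit into one series, in which P no longer appears. -/
lemma integral_kernelRemainder_half {s : ℂ} (hs0 : s ≠ 0) (hs1 : ∀ m : ℕ, s ≠ 2 * (m : ℂ) + 1)
    {P : ℕ} (hP : s.re < 2 * P) :
    ∫ x in (0 : ℝ)..(1 / 2), kernelRemainder s P x
      = ((2 * Real.pi : ℝ) : ℂ) ^ (-s) * ∑' n, circleTerm s n := by
  have hicc : ∀ x ∈ Set.uIcc (0 : ℝ) (1 / 2), |x| ≤ 1 / 2 ∧ 0 ≤ x := by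
    intro x hx
    rw [Set.uIcc_of_le (by norm_num)] at hx
    exact ⟨by rw [abs_of_nonneg hx.1]; exact hx.2, hx.1⟩
  have hH := (hasSum_integral_csinc_cpow (s := s) (M := P) (by linarith)).tsum_eq
  have hA : ContinuousOn (fun x : ℝ => ((|x| : ℝ) : ℂ) ^ (-(s - 2 * (P : ℂ))) * alphaTail s P x)
      (Set.uIcc (0 : ℝ) (1 / 2)) := by
    refine ContinuousOn.mul ?_ ?_
    · exact (contDiff_abs_cpow (n := 0) (by simp; linarith)).continuous.continuousOn
    · exact (differentiableOn_alphaTail s P).continuousOn.comp continuous_ofReal.continuousOn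
        fun x hx => by
          rw [mem_ball_zero_iff, norm_real, Real.norm_eq_abs]
          linarith [(hicc x hx).1]
  have hS : ∀ w : ℂ, ContinuousOn (fun x : ℝ => hurwitzSeries w x + hurwitzSeries w (-x))
      (Set.uIcc (0 : ℝ) (1 / 2)) := by
    intro w
    have hc := (differentiableOn_hurwitzSeries w).continuousOn
    have hb : ∀ x ∈ Set.uIcc (0 : ℝ) (1 / 2), |x| < 1 := fun x hx => by linarith [(hicc x hx).1]
    refine ContinuousOn.add ?_ ?_
    · exact hc.comp continuous_ofReal.continuousOn fun x hx => by simpa using hb x hx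
    · exact hc.comp (continuous_ofReal.neg.continuousOn) fun x hx => by simpa using hb x hx
  have hint : ∫ x in (0 : ℝ)..(1 / 2), ((|x| : ℝ) : ℂ) ^ (-(s - 2 * (P : ℂ))) * alphaTail s P x
      = ∑' n, circleTerm s (n + P) := by
    rw [hH]
    refine intervalIntegral.integral_congr fun x hx => ?_
    obtain ⟨h1, h2⟩ := hicc x hx
    rw [← abs_cpow_mul_csinc_sub hs0 hP (by linarith), abs_of_nonneg h2]
  have hcongr : ∫ x in (0 : ℝ)..(1 / 2), kernelRemainder s P x
      = ∫ x in (0 : ℝ)..(1 / 2), ((2 * Real.pi : ℝ) : ℂ) ^ (-s) *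
      (((|x| : ℝ) : ℂ) ^ (-(s - 2 * P)) * alphaTail s P x - ∑ n ∈ Finset.range P,
        alpha n s * ((s - 2 * n - 1)⁻¹ *
          (hurwitzSeries (s - 2 * n) x + hurwitzSeries (s - 2 * n) (-x)))) :=
    intervalIntegral.integral_congr fun x hx =>
      kernelRemainder_eq hs0 hs1 hP (by linarith [(hicc x hx).1])
  have hterm : ∀ n ∈ Finset.range P, IntervalIntegrable (fun x : ℝ => alpha n s *
      ((s - 2 * n - 1)⁻¹ * (hurwitzSeries (s - 2 * n) x + hurwitzSeries (s - 2 * n) (-x))))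
      volume 0 (1 / 2) := fun n _ =>
    (((hS (s - 2 * n)).intervalIntegrable).const_mul _).const_mul _
  have hterms : IntervalIntegrable (fun x : ℝ => ∑ n ∈ Finset.range P, alpha n s *
      ((s - 2 * n - 1)⁻¹ * (hurwitzSeries (s - 2 * n) x + hurwitzSeries (s - 2 * n) (-x))))
      volume 0 (1 / 2) := by
    have := IntervalIntegrable.sum _ hterm
    refine this.congr (fun x _ => ?_)
    rw [Finset.sum_apply]
  rw [hcongr, intervalIntegral.integral_const_mul,
    intervalIntegral.integral_sub hA.intervalIntegrable hterms, hint,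
    intervalIntegral.integral_finsetSum hterm,
    ← (summable_circleTerm s).sum_add_tsum_nat_add P]
  congr 1
  rw [sub_eq_add_neg, add_comm, ← Finset.sum_neg_distrib]
  congr 1
  refine Finset.sum_congr rfl fun n _ => ?_
  rw [intervalIntegral.integral_const_mul, intervalIntegral.integral_const_mul,
    integral_hurwitzSeries, circleTerm]
  have h1 : s - 2 * n - 1 ≠ 0 := sub_ne_zero.mpr (ne_one_of_odd hs1 n)
  rw [show 2 * (n : ℂ) + 1 - s = -(s - 2 * n - 1) by ring]
  field_simp

lemma integral_kernelRemainder {s : ℂ} (hs0 : s ≠ 0) (hs1 : ∀ m : ℕ, s ≠ 2 * (m : ℂ) + 1)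
    {P : ℕ} (hP : s.re < 2 * P) : ∫ x in (0 : ℝ)..1, kernelRemainder s P x = circleV s := by
  have hc : Continuous (kernelRemainder s P) :=
    (contDiff_kernelRemainder (K := 0) hs0 hs1 (by simpa using hP)).continuous
  have h1 := intervalIntegral.integral_add_adjacent_intervals (a := 0) (b := 1 / 2) (c := 1)
    (hc.intervalIntegrable (μ := volume) _ _) (hc.intervalIntegrable _ _)
  have h2 : ∫ x in (1 / 2 : ℝ)..1, kernelRemainder s P x
      = ∫ x in (0 : ℝ)..(1 / 2), kernelRemainder s P x := by
    have := intervalIntegral.integral_comp_sub_left (a := 0) (b := 1 / 2) (kernelRemainder s P) 1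
    rw [show (1 - 1 / 2 : ℝ) = 1 / 2 by norm_num, sub_zero] at this
    rw [← this]
    congr 1
    ext x
    -- Evenness and periodicity give the symmetry x ↦ 1 - x, so both half-periods contribute
    -- equally.
    rw [show 1 - x = -x + 1 by ring, kernelRemainder_periodic, kernelRemainder_neg]
  rw [← h1, h2, integral_kernelRemainder_half hs0 hs1 hP, circleV_eq_tsum hs1]
  ring

lemma sum_kernelRemainder {s : ℂ} (hs1 : ∀ m : ℕ, s ≠ 2 * (m : ℂ) + 1) (P : ℕ) {N : ℕ}
    (hN : N ≠ 0) : ∑ k ∈ Finset.range N, kernelRemainder s P (k / N)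
      = ∑ k ∈ Finset.range N, rieszKernel s (k / N) - 2 * ((2 * Real.pi : ℝ) : ℂ) ^ (-s) *
        ∑ n ∈ Finset.range P, alpha n s * riemannZeta (s - 2 * n) * (N : ℂ) ^ (s - 2 * n) := by
  simp only [kernelRemainder]
  rw [Finset.sum_sub_distrib, ← Finset.mul_sum, Finset.sum_comm]
  congr 1
  rw [mul_assoc, mul_left_comm, Finset.mul_sum (a := (2 : ℂ))]
  congr 1
  refine Finset.sum_congr rfl fun n _ => ?_
  rw [← Finset.mul_sum, ← Finset.mul_sum, sum_hurwitzZetaEven hN (ne_one_of_odd hs1 n)]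
  ring

/-- Lattice sums of the Riesz kernel. -/
theorem exists_norm_sum_rieszKernel_sub_le {s : ℂ} (hs0 : s ≠ 0)
    (hs1 : ∀ m : ℕ, s ≠ 2 * (m : ℂ) + 1) {P K : ℕ} (hK : 2 ≤ K) (hP : s.re + K < 2 * P) :
    ∃ C : ℝ, ∀ N : ℕ, N ≠ 0 →
      ‖∑ k ∈ Finset.range N, rieszKernel s (k / N) - (circleV s * N +
        2 * ((2 * Real.pi : ℝ) : ℂ) ^ (-s) * ∑ n ∈ Finset.range P,
          alpha n s * riemannZeta (s - 2 * n) * (N : ℂ) ^ (s - 2 * n))‖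
        ≤ C * ((N : ℝ) / (N : ℝ) ^ K) := by
  have hP' : s.re < 2 * P := by linarith [show (0 : ℝ) ≤ K by positivity]
  obtain ⟨C, hC⟩ := trapezoid (kernelRemainder_periodic s P) hK
    (contDiff_kernelRemainder hs0 hs1 hP)
  refine ⟨C, fun N hN => ?_⟩
  have h := hC N hN
  rw [integral_kernelRemainder hs0 hs1 hP', sum_kernelRemainder hs1 P hN] at h
  refine le_trans (le_of_eq ?_) h
  congr 1
  ring

end Remainder

/-! ### From lattice sums to the energy; the exact case s = -2M -/

section Energy

open Complex

lemma norm_unityPoints_sub {N : ℕ} (hN : N ≠ 0) (j k : Fin N) :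
    ‖unityPoints N j - unityPoints N k‖
      = |2 * Real.sin (Real.pi * ((((j : ℕ) : ℝ) - ((k : ℕ) : ℝ)) / N))| := by
  have hN' : (N : ℂ) ≠ 0 := by exact_mod_cast hN
  have e : ∀ i : Fin N, unityPoints N i = exp (I * ((2 * Real.pi * (i : ℕ) / N : ℝ) : ℂ)) := by
    intro i
    rw [unityPoints]
    congr 1
    push_cast
    ring
  have h1 : unityPoints N j - unityPoints N k = exp (I * ((2 * Real.pi * (k : ℕ) / N : ℝ) : ℂ)) *
      (exp (I * ((2 * (Real.pi * ((((j : ℕ) : ℝ) - ((k : ℕ) : ℝ)) / N)) : ℝ) : ℂ)) - 1) := by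
    rw [mul_sub, ← exp_add, e j, e k, mul_one]
    congr 2
    push_cast
    field_simp
    ring
  rw [h1, norm_mul, norm_exp_I_mul_ofReal, one_mul, norm_exp_I_mul_ofReal_sub_one, Real.norm_eq_abs]
  congr 3
  ring

lemma rieszKernel_fin_sub (s : ℂ) {N : ℕ} [NeZero N] (j k : Fin N) :
    rieszKernel s (((j - k : Fin N) : ℕ) / N)
      = rieszKernel s ((((j : ℕ) : ℝ) - ((k : ℕ) : ℝ)) / N) := by
  have hN : (N : ℝ) ≠ 0 := by exact_mod_cast NeZero.ne N
  have h1 : ((j - k : Fin N) : ℕ) + N * ((N - (k : ℕ) + j) / N) = N - (k : ℕ) + j := by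
    rw [Fin.val_sub]
    exact Nat.mod_add_div _ _
  set q := (N - (k : ℕ) + j) / N
  have h2 : (((j - k : Fin N) : ℕ) : ℝ) + N * q = N - (k : ℕ) + (j : ℕ) := by
    have h3 := congrArg (Nat.cast (R := ℝ)) h1
    push_cast [Nat.cast_sub k.2.le] at h3
    exact h3
  have h3 : (((j - k : Fin N) : ℕ) : ℝ) / N
      = (((j : ℕ) : ℝ) - ((k : ℕ) : ℝ)) / N + ((1 - (q : ℤ) : ℤ) : ℝ) * 1 := by
    push_cast
    field_simp
    linarith
  rw [h3, (rieszKernel_periodic s).int_mul (1 - (q : ℤ))]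

/-- The energy of the roots of unity as a lattice sum. -/
theorem unityEnergy_eq {s : ℂ} (hs : s ≠ 0) {N : ℕ} (hN : N ≠ 0) :
    unityEnergy s N = N * ∑ k ∈ Finset.range N, rieszKernel s (k / N) := by
  have : NeZero N := ⟨hN⟩
  rw [unityEnergy, rieszEnergy]
  have hj : ∀ j : Fin N, ∑ k ∈ Finset.univ.erase j,
      ((‖unityPoints N j - unityPoints N k‖ : ℝ) : ℂ) ^ (-s)
        = ∑ k ∈ Finset.range N, rieszKernel s (k / N) := by
    intro j
    have h1 : ∀ k : Fin N, ((‖unityPoints N j - unityPoints N k‖ : ℝ) : ℂ) ^ (-s)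
        = rieszKernel s (((j - k : Fin N) : ℕ) / N) := by
      intro k
      rw [rieszKernel_fin_sub, norm_unityPoints_sub hN, rieszKernel]
    simp only [h1]
    -- The diagonal term may be restored because the kernel vanishes at 0; this is where s ≠ 0
    -- enters.
    rw [Finset.sum_erase _ (by simp [rieszKernel_zero hs]), Finset.sum_range]
    exact Equiv.sum_comp (Equiv.subLeft j) fun i : Fin N => rieszKernel s ((i : ℕ) / N)
  rw [Finset.sum_congr rfl fun j _ => hj j]
  simp

lemma isBigO_unityEnergy {s : ℂ} (hs0 : s ≠ 0) (hs1 : ∀ m : ℕ, s ≠ 2 * (m : ℂ) + 1) (p : ℕ) :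
    (fun N : ℕ => unityEnergy s N - (circleV s * (N : ℂ) ^ 2 + 2 / (2 * (Real.pi : ℂ)) ^ s *
      ∑ n ∈ Finset.range (p + 1), alpha n s * riemannZeta (s - 2 * (n : ℂ)) *
        (N : ℂ) ^ (1 + s - 2 * (n : ℂ))))
      =O[atTop] (fun N : ℕ => (N : ℝ) ^ (-1 + s.re - 2 * (p : ℝ))) := by
  -- Chosen so that the error N·N^(1-K) is at most N^(-1+Re s-2p). The smoothness K may force P well
  -- beyond p + 1.
  obtain ⟨K₀, hK₀⟩ := exists_nat_ge (3 + 2 * (p : ℝ) - s.re)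
  set K : ℕ := K₀ + 2
  have hK : 2 ≤ K := by omega
  have hKre : 3 + 2 * (p : ℝ) - s.re ≤ K := by
    simp only [K]; push_cast; linarith
  obtain ⟨P₀, hP₀⟩ := exists_nat_gt (s.re + K)
  set P : ℕ := P₀ + (p + 1)
  have hP : s.re + K < 2 * P := by
    have h1 : (0 : ℝ) ≤ P₀ := by positivity
    have h2 : (0 : ℝ) ≤ p := by positivity
    simp only [P]
    push_cast
    linarith
  obtain ⟨C, hC⟩ := exists_norm_sum_rieszKernel_sub_le hs0 hs1 hK hP
  set c : ℂ := 2 * ((2 * Real.pi : ℝ) : ℂ) ^ (-s) with hc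
  have hc' : 2 / (2 * (Real.pi : ℂ)) ^ s = c := by
    rw [hc, cpow_neg, div_eq_mul_inv]
    push_cast
    rfl
  -- The surplus terms p < n < P are moved into the error: each has order at most that of n = p + 1,
  -- which is N^(-1+Re s-2p).
  have hsplit : ∀ᶠ N : ℕ in atTop, unityEnergy s N - (circleV s * (N : ℂ) ^ 2 + c *
      ∑ n ∈ Finset.range (p + 1), alpha n s * riemannZeta (s - 2 * (n : ℂ)) *
        (N : ℂ) ^ (1 + s - 2 * (n : ℂ)))
      = N * (∑ k ∈ Finset.range N, rieszKernel s (k / N) - (circleV s * N + c *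
          ∑ n ∈ Finset.range P, alpha n s * riemannZeta (s - 2 * n) * (N : ℂ) ^ (s - 2 * n)))
        + ∑ n ∈ Finset.Ico (p + 1) P, c * (alpha n s * riemannZeta (s - 2 * (n : ℂ))) *
          (N : ℂ) ^ (1 + s - 2 * (n : ℂ)) := by
    filter_upwards [eventually_ne_atTop 0] with N hN
    have hN' : (N : ℂ) ≠ 0 := by exact_mod_cast hN
    have hpow : ∀ n : ℕ, (N : ℂ) ^ (1 + s - 2 * (n : ℂ)) = N * (N : ℂ) ^ (s - 2 * (n : ℂ)) := by
      intro n
      rw [add_sub_assoc, cpow_add _ _ hN', cpow_one]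
    have h1 := Finset.sum_range_add_sum_Ico
      (fun n => alpha n s * riemannZeta (s - 2 * (n : ℂ)) * (N : ℂ) ^ (s - 2 * (n : ℂ)))
      (show p + 1 ≤ P by omega)
    rw [unityEnergy_eq hs0 hN, ← h1]
    simp only [hpow]
    have h2 : ∀ t : Finset ℕ, ∑ n ∈ t, alpha n s * riemannZeta (s - 2 * (n : ℂ)) *
        (N * (N : ℂ) ^ (s - 2 * (n : ℂ))) = N * ∑ n ∈ t, alpha n s *
          riemannZeta (s - 2 * (n : ℂ)) * (N : ℂ) ^ (s - 2 * (n : ℂ)) := fun t => by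
      rw [Finset.mul_sum]
      exact Finset.sum_congr rfl fun n _ => by ring
    have h3 : ∑ n ∈ Finset.Ico (p + 1) P, c * (alpha n s * riemannZeta (s - 2 * (n : ℂ))) *
        (N * (N : ℂ) ^ (s - 2 * (n : ℂ))) = c * (N * ∑ n ∈ Finset.Ico (p + 1) P, alpha n s *
          riemannZeta (s - 2 * (n : ℂ)) * (N : ℂ) ^ (s - 2 * (n : ℂ))) := by
      rw [← h2, Finset.mul_sum]
      exact Finset.sum_congr rfl fun n _ => by ring
    rw [h2, h3]
    ring
  rw [hc']
  refine IsBigO.congr' ?_ (hsplit.mono fun N h => h.symm) EventuallyEq.rfl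
  refine IsBigO.add ?_ (IsBigO.fun_sum fun n hn => ?_)
  · refine IsBigO.of_bound |C| ?_
    filter_upwards [eventually_ge_atTop 1] with N hN
    have hN1 : (1 : ℝ) ≤ N := by exact_mod_cast hN
    have hN0 : (0 : ℝ) < N := by linarith
    rw [norm_mul, Complex.norm_natCast, Real.norm_of_nonneg (by positivity)]
    have hle : (N : ℝ) * ((N : ℝ) / (N : ℝ) ^ K) ≤ (N : ℝ) ^ (-1 + s.re - 2 * (p : ℝ)) := by
      have : (N : ℝ) * ((N : ℝ) / (N : ℝ) ^ K) = (N : ℝ) ^ (2 - (K : ℝ)) := by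
        rw [Real.rpow_sub hN0, Real.rpow_natCast, Real.rpow_two]
        ring
      rw [this]
      exact Real.rpow_le_rpow_of_exponent_le hN1 (by linarith)
    calc (N : ℝ) * _ ≤ N * (C * ((N : ℝ) / (N : ℝ) ^ K)) :=
          mul_le_mul_of_nonneg_left (hC N (by omega)) hN0.le
      _ ≤ N * (|C| * ((N : ℝ) / (N : ℝ) ^ K)) := by
          gcongr
          exact le_abs_self C
      _ = |C| * (N * ((N : ℝ) / (N : ℝ) ^ K)) := by ring
      _ ≤ _ := by gcongr
  · refine IsBigO.of_bound ‖c * (alpha n s * riemannZeta (s - 2 * (n : ℂ)))‖ ?_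
    filter_upwards [eventually_ge_atTop 1] with N hN
    have hN1 : (1 : ℝ) ≤ N := by exact_mod_cast hN
    have hN0 : (0 : ℝ) < N := by linarith
    rw [norm_mul, Real.norm_of_nonneg (by positivity)]
    refine mul_le_mul_of_nonneg_left ?_ (norm_nonneg _)
    rw [← ofReal_natCast, norm_cpow_eq_rpow_re_of_pos hN0]
    refine Real.rpow_le_rpow_of_exponent_le hN1 ?_
    have hn' : (p : ℝ) + 1 ≤ n := by exact_mod_cast (Finset.mem_Ico.mp hn).1
    simp
    linarith

/-- Binomial expansion of (2 sin y)^(2M) = (-1)^M (e^{iy} - e^{-iy})^(2M) with y = πx. -/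
lemma rieszKernel_neg_two_mul (M : ℕ) (x : ℝ) :
    rieszKernel (-2 * (M : ℂ)) x = ∑ j ∈ Finset.range (2 * M + 1),
      (-1) ^ (j + M) * ((2 * M).choose j : ℂ) *
        exp (2 * Real.pi * I * ((j : ℤ) - (M : ℤ) : ℤ) * x) := by
  set y : ℂ := Real.pi * x with hy
  have h1 : rieszKernel (-2 * (M : ℂ)) x = (2 * sin y) ^ (2 * M) := by
    rw [rieszKernel, show -(-2 * (M : ℂ)) = ((2 * M : ℕ) : ℂ) by push_cast; ring, cpow_natCast,
      ← ofReal_pow, pow_mul, sq_abs, ← pow_mul, hy]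
    push_cast
    rfl
  have h2 : (2 * sin y) ^ (2 * M) = (-1) ^ M * (exp (y * I) + -exp (-y * I)) ^ (2 * M) := by
    have : exp (y * I) + -exp (-y * I) = (2 * sin y) * I := by
      rw [sin]
      ring_nf
      rw [I_sq]
      ring
    rw [this, mul_pow _ I, pow_mul I, I_sq]
    rw [mul_left_comm, ← mul_pow]
    norm_num
  rw [h1, h2, add_pow, Finset.mul_sum]
  refine Finset.sum_congr rfl fun j hj => ?_
  have hj' : j ≤ 2 * M := by simpa [Nat.lt_succ_iff] using hj
  have h3 : (-exp (-y * I)) ^ (2 * M - j) = (-1) ^ j * exp (-y * I) ^ (2 * M - j) := by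
    rw [neg_pow]
    congr 1
    have : (-1 : ℂ) ^ (2 * M - j) * (-1) ^ j = 1 := by
      rw [← pow_add, Nat.sub_add_cancel hj', pow_mul]
      simp
    have hsq : (-1 : ℂ) ^ j * (-1) ^ j = 1 := by rw [← mul_pow]; simp
    linear_combination (-1 : ℂ) ^ j * this - (-1 : ℂ) ^ (2 * M - j) * hsq
  have h4 : exp (y * I) ^ j * exp (-y * I) ^ (2 * M - j)
      = exp (2 * Real.pi * I * ((j : ℤ) - (M : ℤ) : ℤ) * x) := by
    rw [← exp_nat_mul, ← exp_nat_mul, ← exp_add]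
    congr 1
    push_cast [Nat.cast_sub hj']
    rw [hy]
    ring
  rw [h3, pow_add, ← h4]
  ring

/-- Both sides are 1 at M = 0 and satisfy (M+1) c(M+1) = 2(2M+1) c(M), by the functional equation of
Γ. -/
lemma circleV_neg_two_mul (M : ℕ) : circleV (-2 * (M : ℂ)) = (Nat.centralBinom M : ℂ) := by
  have hpi := Real.pi_pos
  have hsqne : (Real.sqrt Real.pi : ℂ) ≠ 0 := by
    exact_mod_cast (Real.sqrt_pos.mpr hpi).ne'
  induction M with
  | zero =>
    have hsq : Gamma (1 / 2) = (Real.sqrt Real.pi : ℂ) := by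
      rw [Complex.Gamma_one_half_eq, show (1 / 2 : ℂ) = ((1 / 2 : ℝ) : ℂ) by norm_num,
        ← ofReal_cpow hpi.le, Real.sqrt_eq_rpow]
    simp [circleV, -one_div, hsq, hsqne]
  | succ M ih =>
    have hM : (M : ℂ) + 1 ≠ 0 := by exact_mod_cast M.succ_ne_zero
    have hM2 : (M : ℂ) + 1 / 2 ≠ 0 := by
      intro h
      have := congrArg re h
      simp at this
      linarith [show (0 : ℝ) ≤ M by positivity]
    have hrec : ((M : ℂ) + 1) * circleV (-2 * ((M + 1 : ℕ) : ℂ))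
        = 2 * (2 * M + 1) * circleV (-2 * (M : ℂ)) := by
      have g1 : Gamma ((1 - -2 * ((M + 1 : ℕ) : ℂ)) / 2)
          = (M + 1 / 2) * Gamma ((1 - -2 * (M : ℂ)) / 2) := by
        rw [show (1 - -2 * (M : ℂ)) / 2 = M + 1 / 2 by ring, ← Gamma_add_one _ hM2]
        congr 1
        push_cast
        ring
      have g2 : Gamma (1 - -2 * ((M + 1 : ℕ) : ℂ) / 2)
          = (M + 1) * Gamma (1 - -2 * (M : ℂ) / 2) := by
        rw [show 1 - -2 * (M : ℂ) / 2 = M + 1 by ring, ← Gamma_add_one _ hM]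
        congr 1
        push_cast
        ring
      have g3 : (2 : ℂ) ^ (-(-2 * ((M + 1 : ℕ) : ℂ))) = 4 * (2 : ℂ) ^ (-(-2 * (M : ℂ))) := by
        rw [show -(-2 * ((M + 1 : ℕ) : ℂ)) = ((2 : ℕ) : ℂ) + -(-2 * (M : ℂ)) by push_cast; ring,
          cpow_add _ _ two_ne_zero, cpow_natCast]
        norm_num
      have hG : Gamma (1 - -2 * (M : ℂ) / 2) ≠ 0 := by
        rw [show 1 - -2 * (M : ℂ) / 2 = M + 1 by ring, Gamma_nat_eq_factorial]
        exact_mod_cast M.factorial_ne_zero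
      rw [circleV, circleV, g1, g2, g3]
      field_simp
      ring
    have hc : ((M : ℂ) + 1) * (Nat.centralBinom (M + 1) : ℂ)
        = 2 * (2 * M + 1) * (Nat.centralBinom M : ℂ) := by
      exact_mod_cast Nat.succ_mul_centralBinom_succ M
    apply mul_left_cancel₀ hM
    rw [hrec, hc, ih]

lemma unityEnergy_neg_two_mul {M : ℕ} (hM : 1 ≤ M) {N : ℕ} (hN : M < N) :
    unityEnergy (-2 * (M : ℂ)) N = circleV (-2 * (M : ℂ)) * (N : ℂ) ^ 2 := by
  have hN0 : N ≠ 0 := by omega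
  have hs : (-2 * (M : ℂ)) ≠ 0 := by
    have : (M : ℂ) ≠ 0 := by exact_mod_cast (by omega : M ≠ 0)
    simpa using this
  have hsum : ∑ k ∈ Finset.range N, rieszKernel (-2 * (M : ℂ)) (k / N)
      = (Nat.centralBinom M : ℂ) * N := by
    simp only [rieszKernel_neg_two_mul]
    rw [Finset.sum_comm]
    simp only [← Finset.mul_sum, sum_exp_lattice hN0]
    rw [Finset.sum_eq_single M]
    · rw [if_pos (by simp), Nat.centralBinom, ← two_mul, pow_mul]
      simp
    · intro j hj hne
      have hj' : j ≤ 2 * M := by simpa [Nat.lt_succ_iff] using hj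
      rw [if_neg, mul_zero]
      intro hd
      -- The frequencies j - M lie in [-M, M] and M < N, so 0 is the only multiple of N among them.
      have := Int.eq_zero_of_abs_lt_dvd hd (by rw [abs_lt]; omega)
      omega
    · intro h
      exact absurd (Finset.mem_range.mpr (by omega)) h
  rw [unityEnergy_eq hs hN0, hsum, circleV_neg_two_mul]
  ring

end Energy

end RieszCircle

theorem theorem1 (s : ℂ) (hs0 : s ≠ 0) (hs1 : ∀ m : ℕ, s ≠ 2 * (m : ℂ) + 1) :
    (∀ p : ℕ,
      (fun N : ℕ =>
        RieszCircle.unityEnergy s N -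
          (RieszCircle.circleV s * (N : ℂ) ^ 2 +
            2 / (2 * (Real.pi : ℂ)) ^ s *
              ∑ n ∈ Finset.range (p + 1),
                RieszCircle.alpha n s * riemannZeta (s - 2 * (n : ℂ)) *
                  (N : ℂ) ^ (1 + s - 2 * (n : ℂ))))
        =O[atTop] (fun N : ℕ => (N : ℝ) ^ (-1 + s.re - 2 * (p : ℝ)))) ∧
    (∀ M : ℕ, 1 ≤ M → s = -2 * (M : ℂ) →
      (∀ n : ℕ, riemannZeta (s - 2 * (n : ℂ)) = 0) ∧
      (∀ N : ℕ, M < N →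
        RieszCircle.unityEnergy s N = RieszCircle.circleV s * (N : ℂ) ^ 2)) := by
  refine ⟨RieszCircle.isBigO_unityEnergy hs0 hs1, ?_⟩
  rintro M hM rfl
  refine ⟨fun n => ?_, fun N hN => RieszCircle.unityEnergy_neg_two_mul hM hN⟩
  obtain ⟨m, rfl⟩ := Nat.exists_eq_add_of_le hM
  rw [show -2 * ((1 + m : ℕ) : ℂ) - 2 * (n : ℂ) = -2 * (((m + n : ℕ) : ℂ) + 1) by push_cast; ring]
  exact riemannZeta_neg_two_mul_nat_add_one (m + n)
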